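/- For an integer $P>3$ consider the online problem on $x\in[0,1]$ with losses, for $t=1,2,\dots$, $$f_t(x)=\begin{cases}\tfrac P2\,x,& t \bmod P=1,\\ -x,& t\bmod P=P-2,\\ 0,&\text{otherwise,}\end{cases}$$ whose optimum (the minimizer over $[0,1]$ of the sum over one period) is $x^*=0$. Let $\beta_1,\beta_2\in[0,1)$, $\alpha_0>0$, $\varepsilon>0$, $\alpha_t=\alpha_0/\sqrt t$, let $\Pi$ be the projection onto $[0,1]$, and let $x_0\in[0,1]$. At each step $t\ge 1$ put $g_t=f_t'(x_{t-1})$. ACProp, with $m_0=s_0=0$, is $$m_t=\beta_1m_{t-1}+(1-\beta_1)g_t,\qquad x_t=\Pi\Big(x_{t-1}-\frac{\alpha_t}{\sqrt{s_{t-1}}+\varepsilon}\,g_t\Big),\qquad s_t=\beta_2s_{t-1}+(1-\beta_2)(g_t-m_t)^2 .$$ AdaShift with delay $n=1$, with $v_0=0$, is $$x_t=\Pi\Big(x_{t-1}-\frac{\alpha_t}{\sqrt{v_{t-1}}+\varepsilon}\,g_t\Big),\qquad v_t=\beta_2v_{t-1}+(1-\beta_2)g_t^2 .$$ Say that a method converges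 if $x_t\to x^*=0$, and that it diverges otherwise. Then: 1. There are $\beta_1,\beta_2\in(0,1)$, an integer $P>3$ and $\varepsilon_0>0$ such that for all $0<\varepsilon<\varepsilon_0$, all $\alpha_0>0$ and all $x_0\in[0,1]$, ACProp converges and AdaShift with $n=1$ diverges. 2. The reverse never happens: for all $\beta_1\in[0,1)$, $\beta_2\in(0,1)$ and integers $P>3$ there is $\varepsilon_0>0$ (depending only on $\beta_1,\beta_2,P$) such that for all $0<\varepsilon<\varepsilon_0$, all $\alpha_0>0$ and all $x_0\in[0,1]$, if AdaShift with $n=1$ converges, then ACProp converges. -/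

import Mathlib

open Filter Topology

noncomputable section

/-- The sparse periodic loss at step `t` (steps are numbered from `1`). -/
def sparseLoss (P t : ℕ) (x : ℝ) : ℝ :=
  if t % P = 1 then (P : ℝ) / 2 * x
  else if t % P = P - 2 then -x
  else 0

/-- Projection onto the feasible set `[0,1]`. -/
def proj01 (y : ℝ) : ℝ := max 0 (min 1 y)

/-- The decaying learning rate `α₀ / √t`. -/
def stepSize (α₀ : ℝ) (t : ℕ) : ℝ := α₀ / √(t : ℝ)

/-- State of ACProp: the iterate `x`, the EMA `m` of the gradients and the EMA `s` of
`(g - m) ^ 2`. -/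
structure ACPropState where
  x : ℝ
  m : ℝ
  s : ℝ

/-- ACProp on the online problem `f` over `[0,1]`, started at `x₀` with `m₀ = s₀ = 0`;
step `t + 1` divides by `√s_t + ε`, which does not involve the current gradient. -/
def acpropState (f : ℕ → ℝ → ℝ) (β₁ β₂ α₀ ε x₀ : ℝ) : ℕ → ACPropState
  | 0 => { x := x₀, m := 0, s := 0 }
  | t + 1 =>
    let S := acpropState f β₁ β₂ α₀ ε x₀ t
    let g := deriv (f (t + 1)) S.x
    let m' := β₁ * S.m + (1 - β₁) * g
    { x := proj01 (S.x - stepSize α₀ (t + 1) / (√S.s + ε) * g)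
      m := m'
      s := β₂ * S.s + (1 - β₂) * (g - m') ^ 2 }

/-- The iterate `x_t` of ACProp. -/
def acprop (f : ℕ → ℝ → ℝ) (β₁ β₂ α₀ ε x₀ : ℝ) (t : ℕ) : ℝ :=
  (acpropState f β₁ β₂ α₀ ε x₀ t).x

/-- State of AdaShift with delay `n = 1`: the iterate `x` and the EMA `v` of the squared
gradients. -/
structure AdaShiftState where
  x : ℝ
  v : ℝ

/-- AdaShift with delay `n = 1` on the online problem `f` over `[0,1]`, started at `x₀` with
`v₀ = 0`; step `t + 1` divides by `√v_t + ε`. For `n = 1` the numerator is the current gradient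
alone, so `β₁` plays no role. -/
def adashiftState (f : ℕ → ℝ → ℝ) (β₂ α₀ ε x₀ : ℝ) : ℕ → AdaShiftState
  | 0 => { x := x₀, v := 0 }
  | t + 1 =>
    let S := adashiftState f β₂ α₀ ε x₀ t
    let g := deriv (f (t + 1)) S.x
    { x := proj01 (S.x - stepSize α₀ (t + 1) / (√S.v + ε) * g)
      v := β₂ * S.v + (1 - β₂) * g ^ 2 }

/-- The iterate `x_t` of AdaShift with delay `n = 1`. -/
def adashift (f : ℕ → ℝ → ℝ) (β₂ α₀ ε x₀ : ℝ) (t : ℕ) : ℝ :=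
  (adashiftState f β₂ α₀ ε x₀ t).x

/-- On the sparse problem, the ACProp iterates converge to the optimum `x* = 0`. (The losses of
one period add up to `(P / 2 - 1) * x`, which is minimal on `[0,1]` at `0` only.) -/
def ACPropConverges (β₁ β₂ : ℝ) (P : ℕ) (ε α₀ x₀ : ℝ) : Prop :=
  Tendsto (acprop (sparseLoss P) β₁ β₂ α₀ ε x₀) atTop (𝓝 0)

/-- On the sparse problem, the iterates of AdaShift with delay `n = 1` converge to the optimum
`x* = 0`. -/
def AdaShiftConverges (β₂ : ℝ) (P : ℕ) (ε α₀ x₀ : ℝ) : Prop :=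
  Tendsto (adashift (sparseLoss P) β₂ α₀ ε x₀) atTop (𝓝 0)

end

/-! The losses are affine, so the gradients, and with them the moment sequences of both methods, do
not depend on the iterates. The moments are exponential averages of (asymptotically) periodic inputs
and converge along each residue class modulo `P`. Let `G = P / 2`, and let `A` and `B` be the limits
of the second moment just before the gradients `G` and `-1`. Up to projection, one period moves the
iterate down by a step size times a weight tending to `D = G / (√A + ε) - 1 / (√B + ε)`. The step
sizes are not summable over the periods, so `D > 0` forces convergence to `0`
(`sparse_descent_tendsto_zero`) and `D < 0` excludes it (`sparse_descent_not_tendsto_zero`).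

Since `G > 1`, the inequality `A ≤ G ^ 2 * B` gives `D > 0` for every `ε > 0`, while `G ^ 2 * B < A`
gives `D < 0` for small `ε`. Everything is thus reduced to the sign of `G ^ 2 * B - A`. For AdaShift
it is nonnegative exactly when `β₂ ^ 2 ≤ G ^ 4 * β₂ ^ (P - 4)` (`adashift_limit_le_iff`). The core
of the proof is that this same condition implies `A ≤ G ^ 2 * B` for ACProp, whatever `β₁` is
(`acprop_limit_le`). If the condition holds, ACProp converges for every `ε`; if it fails, AdaShift
diverges for small `ε`. The first claim only needs parameters where the condition fails and the
ACProp inequality still holds. -/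

/-! ### Gradients of the sparse losses and the projection. -/

/-- The derivative of `sparseLoss P t`, which does not depend on the point. -/
noncomputable def sparseGrad (P t : ℕ) : ℝ :=
  if t % P = 1 then (P : ℝ) / 2 else if t % P = P - 2 then -1 else 0

theorem deriv_sparseLoss (P t : ℕ) (x : ℝ) : deriv (sparseLoss P t) x = sparseGrad P t := by
  unfold sparseGrad
  split_ifs with h1 h2
  · have : sparseLoss P t = fun x => (P : ℝ) / 2 * x := by ext x; simp [sparseLoss, h1]
    rw [this]; simp
  · have : sparseLoss P t = fun x => -x := by
      ext x; unfold sparseLoss; rw [if_neg h1, if_pos h2]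
    rw [this]; exact (hasDerivAt_id x).neg.deriv
  · have : sparseLoss P t = fun _ => 0 := by ext x; simp [sparseLoss, h1, h2]
    rw [this]; simp

theorem sparseGrad_mul_add {P : ℕ} (k j : ℕ) : sparseGrad P (k * P + j) = sparseGrad P j := by
  unfold sparseGrad
  rw [Nat.add_comm, Nat.add_mul_mod_self_right]

theorem sparseGrad_one {P : ℕ} (hP : 3 < P) : sparseGrad P 1 = (P : ℝ) / 2 := by
  unfold sparseGrad
  rw [Nat.mod_eq_of_lt (by omega), if_pos rfl]

theorem sparseGrad_sub_two {P : ℕ} (hP : 3 < P) : sparseGrad P (P - 2) = -1 := by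
  unfold sparseGrad
  rw [Nat.mod_eq_of_lt (by omega), if_neg (by omega), if_pos rfl]

theorem sparseGrad_eq_zero {P j : ℕ} (hj : j < P) (h1 : j ≠ 1) (h2 : j ≠ P - 2) :
    sparseGrad P j = 0 := by
  unfold sparseGrad
  rw [Nat.mod_eq_of_lt hj, if_neg h1, if_neg h2]

theorem sparseGrad_self {P : ℕ} (hP : 3 < P) : sparseGrad P P = 0 := by
  unfold sparseGrad
  rw [Nat.mod_self, if_neg (by omega), if_neg (by omega)]

theorem proj01_nonneg (y : ℝ) : 0 ≤ proj01 y := le_max_left _ _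

theorem proj01_le_one (y : ℝ) : proj01 y ≤ 1 :=
  max_le zero_le_one (min_le_left _ _)

theorem proj01_eq_self {y : ℝ} (hy : y ∈ Set.Icc (0 : ℝ) 1) : proj01 y = y := by
  unfold proj01; rw [min_eq_right hy.2, max_eq_right hy.1]

theorem proj01_le_max (y : ℝ) : proj01 y ≤ max 0 y :=
  max_le_max le_rfl (min_le_right _ _)

theorem min_one_le_proj01 (y : ℝ) : min 1 y ≤ proj01 y := le_max_right _ _

/-! ### Real sequences with nonsummable drift. -/

/-- A nonnegative sequence that decreases by a nonsummable amount, up to a vanishing floor,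
tends to zero. -/
theorem tendsto_zero_of_le_max_sub {y u γ : ℕ → ℝ} (hy : ∀ k, 0 ≤ y k)
    (hu : Tendsto u atTop (𝓝 0)) (hγ : ∀ᶠ k in atTop, 0 ≤ γ k)
    (hsum : ∀ N, Tendsto (fun n => ∑ i ∈ Finset.range n, γ (N + i)) atTop atTop)
    (h : ∀ k, y (k + 1) ≤ max (u k) (y k - γ k)) : Tendsto y atTop (𝓝 0) := by
  rw [Metric.tendsto_atTop]
  intro δ hδ
  obtain ⟨N, hN⟩ := eventually_atTop.1
    (hγ.and (hu.eventually (gt_mem_nhds (half_pos hδ))))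
  have hex : ∃ k, N ≤ k ∧ y k ≤ δ / 2 := by
    by_contra! hcon
    have hle : ∀ n, y (N + n) ≤ y N - ∑ i ∈ Finset.range n, γ (N + i) := by
      intro n
      induction n with
      | zero => simp
      | succ n ih =>
        rw [Finset.sum_range_succ]
        have h1 := hcon (N + n + 1) (by omega)
        have h2 := h (N + n)
        have h3 := (hN (N + n) (by omega)).2
        rcases le_max_iff.1 h2 with h4 | h4
        · linarith
        · rw [← add_assoc]; linarith
    obtain ⟨n, hn⟩ := ((hsum N).eventually_gt_atTop (y N)).exists
    linarith [hle n, hy (N + n)]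
  obtain ⟨K, hK, hyK⟩ := hex
  refine ⟨K, fun k hk => ?_⟩
  have : y k ≤ δ / 2 := by
    induction k, hk using Nat.le_induction with
    | base => exact hyK
    | succ k hk ih =>
      refine (h k).trans (max_le (hN k (by omega)).2.le ?_)
      linarith [(hN k (by omega)).1]
  rw [Real.dist_eq, sub_zero, abs_of_nonneg (hy k)]
  linarith

/-- If `y` tended to `0`, the cap `1` would eventually be inactive, and `y` would grow by a
divergent sum. -/
theorem not_tendsto_zero_of_add_le {y γ : ℕ → ℝ}
    (hsum : ∀ N, Tendsto (fun n => ∑ i ∈ Finset.range n, γ (N + i)) atTop atTop)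
    (h : ∀ k, min 1 (y k + γ k) ≤ y (k + 1)) : ¬ Tendsto y atTop (𝓝 0) := by
  intro hy
  obtain ⟨N, hN⟩ := eventually_atTop.1
    ((hy.eventually (gt_mem_nhds zero_lt_one)))
  have hle : ∀ n, y N + ∑ i ∈ Finset.range n, γ (N + i) ≤ y (N + n) := by
    intro n
    induction n with
    | zero => simp
    | succ n ih =>
      rw [Finset.sum_range_succ]
      rcases min_le_iff.1 (h (N + n)) with h1 | h1
      · exact absurd h1 (not_le.2 (hN (N + n + 1) (by omega)))
      · rw [← add_assoc, ← add_assoc]; linarith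
  obtain ⟨n, hn⟩ := ((hsum N).eventually_gt_atTop (1 - y N)).exists
  linarith [hle n, hN (N + n) (by omega)]

/-- Shifted partial sums of a sequence `a k * w k` diverge when `w` has a positive limit and `a`
dominates a positive multiple of the harmonic sequence. -/
theorem tendsto_sum_mul_atTop {a w : ℕ → ℝ} {c D : ℝ} (hc : 0 < c) (hD : 0 < D)
    (ha : ∀ k, c / (k + 1) ≤ a k) (hw : Tendsto w atTop (𝓝 D)) (N : ℕ) :
    Tendsto (fun n => ∑ i ∈ Finset.range n, a (N + i) * w (N + i)) atTop atTop := by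
  obtain ⟨K, hK⟩ := eventually_atTop.1 (hw.eventually (lt_mem_nhds (half_lt_self hD)))
  have key : ∀ n, ∑ i ∈ Finset.range K, a (N + i) * w (N + i) +
      (c * (D / 2)) * ∑ i ∈ Finset.range n, 1 / (((N + K + i : ℕ) : ℝ) + 1) ≤
      ∑ i ∈ Finset.range (K + n), a (N + i) * w (N + i) := by
    intro n
    rw [Finset.sum_range_add, Finset.mul_sum]
    refine add_le_add le_rfl (Finset.sum_le_sum fun i _ => ?_)
    have h1 := ha (N + K + i)
    have h2 := hK (N + K + i) (by omega)
    rw [show N + (K + i) = N + K + i by omega]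
    have h3 : 0 < c / (((N + K + i : ℕ) : ℝ) + 1) := by positivity
    calc c * (D / 2) * (1 / (((N + K + i : ℕ) : ℝ) + 1))
        = c / (((N + K + i : ℕ) : ℝ) + 1) * (D / 2) := by ring
      _ ≤ _ := mul_le_mul h1 h2.le (by positivity) (h3.le.trans h1)
  have hharm : Tendsto (fun n => ∑ i ∈ Finset.range n, 1 / (((N + K + i : ℕ) : ℝ) + 1))
      atTop atTop := by
    have h0 := Real.tendsto_sum_range_one_div_nat_succ_atTop
    have h1 := (tendsto_add_atTop_iff_nat (N + K)).2 h0
    have h2 := tendsto_atTop_add_const_right atTop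
      (-∑ i ∈ Finset.range (N + K), 1 / ((i : ℝ) + 1)) h1
    refine h2.congr fun n => ?_
    rw [add_comm n, Finset.sum_range_add]
    ring
  rw [← tendsto_add_atTop_iff_nat K]
  refine tendsto_atTop_mono (fun n => ?_)
    (tendsto_atTop_add_const_left atTop (∑ i ∈ Finset.range K, a (N + i) * w (N + i))
      (hharm.const_mul_atTop (by positivity : 0 < c * (D / 2))))
  rw [add_comm n]
  exact key n

/-! ### The drift over one period decides convergence. -/

/-- One period of projected descent along the sparse gradients. -/
theorem sparse_descent_period {P : ℕ} (hP : 3 < P) {x a : ℕ → ℝ}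
    (hx01 : ∀ t, x t ∈ Set.Icc (0 : ℝ) 1)
    (hx : ∀ t, x (t + 1) = proj01 (x t - a t * sparseGrad P (t + 1))) (k : ℕ) :
    (∀ j, 1 ≤ j → j ≤ P - 3 → x (k * P + j) = proj01 (x (k * P) - a (k * P) * (P / 2))) ∧
    (∀ j, P - 2 ≤ j → j ≤ P →
      x (k * P + j) = proj01 (x (k * P + 1) + a (k * P + (P - 3)))) := by
  have hstep : ∀ j, x (k * P + (j + 1)) =
      proj01 (x (k * P + j) - a (k * P + j) * sparseGrad P (j + 1)) := by
    intro j
    rw [← sparseGrad_mul_add k (j + 1), ← add_assoc, hx]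
  have hzero : ∀ j, sparseGrad P (j + 1) = 0 → x (k * P + (j + 1)) = x (k * P + j) := by
    intro j hj
    rw [hstep, hj, mul_zero, sub_zero, proj01_eq_self (hx01 _)]
  have first : ∀ j, 1 ≤ j → j ≤ P - 3 →
      x (k * P + j) = proj01 (x (k * P) - a (k * P) * (P / 2)) := by
    intro j hj
    induction j, hj using Nat.le_induction with
    | base =>
      intro _
      have := hstep 0
      rw [sparseGrad_one hP] at this
      simpa using this
    | succ j hj ih =>
      intro hj'
      rw [hzero j (sparseGrad_eq_zero (by omega) (by omega) (by omega)), ih (by omega)]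
  refine ⟨first, fun j hj => ?_⟩
  induction j, hj using Nat.le_induction with
  | base =>
    intro _
    have := hstep (P - 3)
    rw [show P - 3 + 1 = P - 2 by omega, sparseGrad_sub_two hP, first (P - 3) (by omega) le_rfl,
      ← first 1 le_rfl (by omega)] at this
    rw [this]; congr 1; ring
  | succ j hj ih =>
    intro hj'
    rw [hzero j ?_, ih (by omega)]
    rcases Nat.lt_or_ge (j + 1) P with h | h
    · exact sparseGrad_eq_zero h (by omega) (by omega)
    · rw [show j + 1 = P by omega]; exact sparseGrad_self hP

/-- The step sizes inside a period, relative to each other and to the harmonic sequence. -/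
theorem stepSize_ratio_tendsto {P : ℕ} (hP : 3 < P) :
    Tendsto (fun k : ℕ => √((k * P + (P - 3) + 1 : ℕ) : ℝ) / √((k * P + 1 : ℕ) : ℝ)) atTop
      (𝓝 1) := by
  have hpos : ∀ k : ℕ, (0 : ℝ) < ((k * P + 1 : ℕ) : ℝ) := fun k => by positivity
  have hden : Tendsto (fun k : ℕ => ((k * P + 1 : ℕ) : ℝ)) atTop atTop :=
    tendsto_natCast_atTop_atTop.comp
      (tendsto_atTop_mono (fun k => by nlinarith : ∀ k : ℕ, k ≤ k * P + 1) tendsto_id)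
  have h1 : Tendsto (fun k : ℕ => 1 + ((P - 3 : ℕ) : ℝ) / ((k * P + 1 : ℕ) : ℝ)) atTop
      (𝓝 (1 + 0)) := tendsto_const_nhds.add (hden.const_div_atTop _)
  have h2 := (Real.continuous_sqrt.tendsto _).comp h1
  rw [add_zero, Real.sqrt_one] at h2
  refine h2.congr fun k => ?_
  rw [← Real.sqrt_div (Nat.cast_nonneg _)]
  simp only [Function.comp]
  congr 1
  have := hpos k
  rw [eq_div_iff this.ne', add_mul, div_mul_cancel₀ _ this.ne']
  push_cast
  ring

theorem stepSize_tendsto_zero (α₀ : ℝ) : Tendsto (stepSize α₀) atTop (𝓝 0) := by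
  unfold stepSize
  exact (Real.tendsto_sqrt_atTop.comp tendsto_natCast_atTop_atTop).const_div_atTop α₀

theorem stepSize_pos {α₀ : ℝ} (h : 0 < α₀) {t : ℕ} (ht : 0 < t) : 0 < stepSize α₀ t := by
  unfold stepSize; positivity

/-- The crude bound `√y ≤ y` for `y ≥ 1` is enough, since only divergence of the sum matters. -/
theorem harmonic_le_stepSize {P : ℕ} (hP : 3 < P) {α₀ : ℝ} (hα : 0 < α₀) (k : ℕ) :
    α₀ / P / (k + 1) ≤ stepSize α₀ (k * P + (P - 3) + 1) := by
  unfold stepSize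
  rw [div_div]
  refine div_le_div_of_nonneg_left hα.le (by positivity) ?_
  have h1 : ((k * P + (P - 3) + 1 : ℕ) : ℝ) ≤ P * (k + 1) := by
    have : k * P + (P - 3) + 1 ≤ P * (k + 1) := by
      rw [mul_add, mul_comm P k]; omega
    exact_mod_cast this
  refine Real.sqrt_le_iff.2 ⟨by positivity, h1.trans ?_⟩
  have : (1 : ℝ) ≤ P * (k + 1) := by
    have : 1 ≤ P * (k + 1) := Nat.mul_pos (by omega) (by omega)
    exact_mod_cast this
  nlinarith

section Descent

variable {P : ℕ} {α₀ ε A B : ℝ} {x s : ℕ → ℝ}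

/-- The net drift of a period is the second step size times a convergent weight. -/
theorem exists_sparse_descent_weight (hP : 3 < P) (hε : 0 < ε) (α₀ : ℝ)
    (hA : Tendsto (fun k => s (k * P)) atTop (𝓝 A))
    (hB : Tendsto (fun k => s (k * P + (P - 3))) atTop (𝓝 B)) :
    ∃ w : ℕ → ℝ, Tendsto w atTop (𝓝 (P / 2 / (√A + ε) - 1 / (√B + ε))) ∧
      ∀ k, stepSize α₀ (k * P + (P - 3) + 1) * w k =
        stepSize α₀ (k * P + 1) / (√(s (k * P)) + ε) * (P / 2) -
          stepSize α₀ (k * P + (P - 3) + 1) / (√(s (k * P + (P - 3))) + ε) := by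
  have hpA : √A + ε ≠ 0 := by positivity
  have hpB : √B + ε ≠ 0 := by positivity
  have h1 := ((hA.sqrt).add_const ε)
  have h2 := ((hB.sqrt).add_const ε)
  have h3 := (stepSize_ratio_tendsto hP).mul
    ((tendsto_const_nhds (x := (P : ℝ) / 2)).div h1 hpA)
  rw [one_mul] at h3
  refine ⟨_, h3.sub ((tendsto_const_nhds (x := (1 : ℝ))).div h2 hpB), fun k => ?_⟩
  unfold stepSize
  have h1 : √((k * P + (P - 3) + 1 : ℕ) : ℝ) ≠ 0 := by positivity
  have : α₀ / √((k * P + 1 : ℕ) : ℝ) = α₀ / √((k * P + (P - 3) + 1 : ℕ) : ℝ) *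
    (√((k * P + (P - 3) + 1 : ℕ) : ℝ) / √((k * P + 1 : ℕ) : ℝ)) := by
    field_simp
  rw [this]
  simp only [Pi.div_apply]
  ring

/-- If the downward step is cut off at `0`, the period ends no higher than its upward step, which
tends to `0`; otherwise the full drift is realised. This is the dichotomy in
`tendsto_zero_of_le_max_sub`. -/
theorem sparse_descent_tendsto_zero (hP : 3 < P) (hα : 0 < α₀) (hε : 0 < ε)
    (hx0 : x 0 ∈ Set.Icc (0 : ℝ) 1)
    (hx : ∀ t, x (t + 1) =
      proj01 (x t - stepSize α₀ (t + 1) / (√(s t) + ε) * sparseGrad P (t + 1)))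
    (hA : Tendsto (fun k => s (k * P)) atTop (𝓝 A))
    (hB : Tendsto (fun k => s (k * P + (P - 3))) atTop (𝓝 B))
    (hD : 1 / (√B + ε) < P / 2 / (√A + ε)) : Tendsto x atTop (𝓝 0) := by
  have hx01 : ∀ t, x t ∈ Set.Icc (0 : ℝ) 1 := by
    rintro (_ | t)
    · exact hx0
    · rw [hx]; exact ⟨proj01_nonneg _, proj01_le_one _⟩
  have hper := sparse_descent_period hP hx01 hx
  obtain ⟨w, hw, hdrift⟩ := exists_sparse_descent_weight hP hε α₀ hA hB
  have hsum := tendsto_sum_mul_atTop (a := fun k => stepSize α₀ (k * P + (P - 3) + 1))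
    (by positivity : 0 < α₀ / P) (sub_pos.2 hD) (harmonic_le_stepSize hP hα) hw
  have hup : Tendsto (fun k : ℕ => stepSize α₀ (k * P + (P - 3) + 1) /
      (√(s (k * P + (P - 3))) + ε)) atTop (𝓝 0) := by
    have h1 : Tendsto (fun k : ℕ => k * P + (P - 3) + 1) atTop atTop :=
      tendsto_atTop_mono (fun k => by
        have := Nat.le_mul_of_pos_right k (show 0 < P by omega)
        show k ≤ k * P + (P - 3) + 1
        omega)
        tendsto_id
    have h2 := ((stepSize_tendsto_zero α₀).comp h1).div ((hB.sqrt).add_const ε)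
      (by positivity)
    rw [zero_div] at h2
    exact h2
  have hy : Tendsto (fun k => x (k * P)) atTop (𝓝 0) := by
    refine tendsto_zero_of_le_max_sub
      (γ := fun k => stepSize α₀ (k * P + (P - 3) + 1) * w k) (fun k => (hx01 _).1) hup ?_
      hsum fun k => ?_
    · filter_upwards [hw.eventually (lt_mem_nhds (sub_pos.2 hD))] with k hk
      exact mul_nonneg (stepSize_pos hα (by omega)).le hk.le
    · have h1 := (hper k).2 P (by omega) le_rfl
      have h2 := (hper k).1 1 le_rfl (by omega)
      rw [add_mul, one_mul, h1, h2]
      rw [hdrift]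
      have hu0 : 0 ≤ stepSize α₀ (k * P + (P - 3) + 1) / (√(s (k * P + (P - 3))) + ε) :=
        div_nonneg (stepSize_pos hα (by omega)).le (by positivity)
      refine (proj01_le_max _).trans (max_le (hu0.trans (le_max_left _ _)) ?_)
      rcases le_max_iff.1 (proj01_le_max
        (x (k * P) - stepSize α₀ (k * P + 1) / (√(s (k * P)) + ε) * (P / 2))) with h | h
      · exact le_max_of_le_left (by linarith)
      · exact le_max_of_le_right (by linarith)
  have hy' : Tendsto (fun k => x ((k + 1) * P)) atTop (𝓝 0) := (tendsto_add_atTop_iff_nat 1).2 hy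
  -- Inside a period the iterate first stays at or below its starting value, then equals its final
  -- value, so the two endpoints control it.
  have hmax : Tendsto (fun k => max (x (k * P)) (x ((k + 1) * P))) atTop (𝓝 0) := by
    simpa using hy.max hy'
  have hdiv : Tendsto (fun t : ℕ => t / P) atTop atTop :=
    Nat.tendsto_div_const_atTop (by omega)
  refine squeeze_zero (fun t => (hx01 t).1) (fun t => ?_) (hmax.comp hdiv)
  simp only [Function.comp]
  set k := t / P
  have ht : t = k * P + t % P := by rw [mul_comm]; exact (Nat.div_add_mod t P).symm
  have hlt : t % P < P := Nat.mod_lt _ (by omega)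
  rcases Nat.eq_zero_or_pos (t % P) with h0 | h0
  · rw [ht, h0]; exact le_max_left _ _
  rcases Nat.lt_or_ge (t % P) (P - 2) with h3 | h3
  · refine le_max_of_le_left ?_
    rw [ht, (hper k).1 _ h0 (by omega)]
    refine (proj01_le_max _).trans (max_le (hx01 _).1 ?_)
    have : 0 ≤ stepSize α₀ (k * P + 1) / (√(s (k * P)) + ε) * (P / 2) :=
      mul_nonneg (div_nonneg (stepSize_pos hα (by omega)).le (by positivity)) (by positivity)
    linarith
  · refine le_max_of_le_right (le_of_eq ?_)
    rw [ht, (hper k).2 _ h3 hlt.le, add_mul, one_mul, (hper k).2 P (by omega) le_rfl]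

/-- Truncation at `0` only raises the iterate, so the upward drift is realised in full unless the
cap `1` is reached. -/
theorem sparse_descent_not_tendsto_zero (hP : 3 < P) (hα : 0 < α₀) (hε : 0 < ε)
    (hx0 : x 0 ∈ Set.Icc (0 : ℝ) 1)
    (hx : ∀ t, x (t + 1) =
      proj01 (x t - stepSize α₀ (t + 1) / (√(s t) + ε) * sparseGrad P (t + 1)))
    (hA : Tendsto (fun k => s (k * P)) atTop (𝓝 A))
    (hB : Tendsto (fun k => s (k * P + (P - 3))) atTop (𝓝 B))
    (hD : P / 2 / (√A + ε) < 1 / (√B + ε)) : ¬ Tendsto x atTop (𝓝 0) := by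
  have hx01 : ∀ t, x t ∈ Set.Icc (0 : ℝ) 1 := by
    rintro (_ | t)
    · exact hx0
    · rw [hx]; exact ⟨proj01_nonneg _, proj01_le_one _⟩
  have hper := sparse_descent_period hP hx01 hx
  obtain ⟨w, hw, hdrift⟩ := exists_sparse_descent_weight hP hε α₀ hA hB
  have hsum := tendsto_sum_mul_atTop (a := fun k => stepSize α₀ (k * P + (P - 3) + 1))
    (w := fun k => -w k)
    (by positivity : 0 < α₀ / P) (by linarith) (harmonic_le_stepSize hP hα) hw.neg
  intro hlim
  have hkP : Tendsto (fun k : ℕ => k * P) atTop atTop :=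
    tendsto_atTop_mono (fun k => Nat.le_mul_of_pos_right k (show 0 < P by omega)) tendsto_id
  have hyP := hlim.comp hkP
  refine not_tendsto_zero_of_add_le (y := fun k => x (k * P))
    (γ := fun k => stepSize α₀ (k * P + (P - 3) + 1) * -w k)
    hsum (fun k => ?_) hyP
  have h1 := (hper k).2 P (by omega) le_rfl
  have h2 := (hper k).1 1 le_rfl (by omega)
  rw [mul_neg, hdrift, add_mul, one_mul, h1, h2]
  refine le_trans (min_le_min le_rfl ?_) (min_one_le_proj01 _)
  have h3 := min_one_le_proj01
    (x (k * P) - stepSize α₀ (k * P + 1) / (√(s (k * P)) + ε) * (P / 2))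
  have : 0 ≤ stepSize α₀ (k * P + 1) / (√(s (k * P)) + ε) * (P / 2) :=
    mul_nonneg (div_nonneg (stepSize_pos hα (by omega)).le (by positivity)) (by positivity)
  rw [min_eq_right (by linarith [(hx01 (k * P)).2])] at h3
  linarith

end Descent

/-! ### Periodic limits of the exponential moving averages. -/

/-- The distance to the fixed point of the limiting map contracts by `ρ` at each step, up to a
vanishing perturbation. -/
theorem tendsto_of_affine_recurrence {a γ : ℕ → ℝ} {ρ c : ℝ} (h0 : 0 ≤ ρ) (h1 : ρ < 1)
    (hγ : Tendsto γ atTop (𝓝 c)) (h : ∀ k, a (k + 1) = ρ * a k + γ k) :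
    Tendsto a atTop (𝓝 (c / (1 - ρ))) := by
  have hρ : 0 < 1 - ρ := by linarith
  set L := c / (1 - ρ)
  have hL : ρ * L + c = L := by simp only [L]; field_simp; ring
  have hmain : Tendsto (fun k => |a k - L|) atTop (𝓝 0) := by
    rw [Metric.tendsto_atTop]
    intro δ hδ
    obtain ⟨N, hN⟩ := Metric.tendsto_atTop.1 hγ (δ / 2 * (1 - ρ)) (by positivity)
    have hb : ∀ n, |a (N + n) - L| ≤ ρ ^ n * |a N - L| + δ / 2 := by
      intro n
      induction n with
      | zero => simp; positivity
      | succ n ih =>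
        have e : a (N + (n + 1)) - L = ρ * (a (N + n) - L) + (γ (N + n) - c) := by
          rw [← add_assoc, h]; linarith
        have h2 := hN (N + n) (by omega)
        rw [Real.dist_eq] at h2
        calc |a (N + (n + 1)) - L| ≤ ρ * |a (N + n) - L| + |γ (N + n) - c| := by
              rw [e]; refine (abs_add_le _ _).trans ?_
              rw [abs_mul, abs_of_nonneg h0]
          _ ≤ ρ * (ρ ^ n * |a N - L| + δ / 2) + δ / 2 * (1 - ρ) :=
              add_le_add (mul_le_mul_of_nonneg_left ih h0) h2.le
          _ = _ := by ring
    have hp : Tendsto (fun n => ρ ^ n * |a N - L|) atTop (𝓝 0) := by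
      simpa using (tendsto_pow_atTop_nhds_zero_of_lt_one h0 h1).mul_const (|a N - L|)
    obtain ⟨M, hM⟩ := eventually_atTop.1 (hp.eventually (gt_mem_nhds (half_pos hδ)))
    refine ⟨N + M, fun k hk => ?_⟩
    obtain ⟨n, rfl⟩ := Nat.exists_eq_add_of_le (show N ≤ k by omega)
    rw [Real.dist_eq, sub_zero, abs_abs]
    linarith [hb n, hM n (by omega)]
  have := tendsto_sub_nhds_zero_iff.1 ((tendsto_zero_iff_abs_tendsto_zero _).2 hmain)
  exact this

/-- An exponential moving average of an asymptotically periodic sequence is asymptotically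
periodic. -/
theorem exists_periodic_limit {P : ℕ} (hP : 0 < P) {a c C : ℕ → ℝ} {ρ : ℝ}
    (h0 : 0 ≤ ρ) (h1 : ρ < 1) (hc : ∀ j, Tendsto (fun k => c (k * P + j)) atTop (𝓝 (C j)))
    (h : ∀ t, a (t + 1) = ρ * a t + c t) :
    ∃ L : ℕ → ℝ, (∀ j, Tendsto (fun k => a (k * P + j)) atTop (𝓝 (L j))) ∧
      (∀ j, L (j + 1) = ρ * L j + C j) ∧ ∀ j, L (j + P) = L j := by
  have hunroll : ∀ t n, a (t + n) =
      ρ ^ n * a t + ∑ i ∈ Finset.range n, ρ ^ (n - 1 - i) * c (t + i) := by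
    intro t n
    induction n with
    | zero => simp
    | succ n ih =>
      rw [← add_assoc, h, ih, Finset.sum_range_succ, mul_add, Finset.mul_sum, pow_succ]
      have : ∑ i ∈ Finset.range n, ρ * (ρ ^ (n - 1 - i) * c (t + i)) =
          ∑ i ∈ Finset.range n, ρ ^ (n + 1 - 1 - i) * c (t + i) := by
        refine Finset.sum_congr rfl fun i hi => ?_
        rw [Finset.mem_range] at hi
        rw [← mul_assoc, ← pow_succ', show n - 1 - i + 1 = n + 1 - 1 - i by omega]
      rw [this]
      simp
      ring
  have hex : ∀ j, ∃ L, Tendsto (fun k => a (k * P + j)) atTop (𝓝 L) := by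
    intro j
    -- Along a residue class, a whole period acts as one affine step with factor `ρ ^ P`.
    refine ⟨_, tendsto_of_affine_recurrence (pow_nonneg h0 P) (pow_lt_one₀ h0 h1 hP.ne')
      (γ := fun k => ∑ i ∈ Finset.range P, ρ ^ (P - 1 - i) * c (k * P + (j + i)))
      (tendsto_finsetSum _ fun i _ => (hc (j + i)).const_mul _) fun k => ?_⟩
    rw [show (k + 1) * P + j = k * P + j + P by ring, hunroll]
    simp only [add_assoc]
  choose L hL using hex
  refine ⟨L, hL, fun j => ?_, fun j => ?_⟩
  · refine tendsto_nhds_unique (hL (j + 1)) ?_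
    refine (((hL j).const_mul ρ).add (hc j)).congr fun k => ?_
    rw [← h, add_assoc]
  · refine tendsto_nhds_unique (hL (j + P)) ?_
    refine ((tendsto_add_atTop_iff_nat 1).2 (hL j)).congr fun k => ?_
    congr 1; ring

/-- Unrolling of the recurrence `L (j + 1) = ρ L j + C (j + 1)`. -/
theorem recurrence_unroll {L C : ℕ → ℝ} {ρ : ℝ} (h : ∀ j, L (j + 1) = ρ * L j + C (j + 1))
    (j n : ℕ) :
    L (j + n) = ρ ^ n * L j + ∑ i ∈ Finset.range n, ρ ^ i * C (j + n - i) := by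
  induction n with
  | zero => simp
  | succ n ih =>
    rw [← add_assoc, h, ih, Finset.sum_range_succ', mul_add, Finset.mul_sum, pow_succ]
    have : ∑ i ∈ Finset.range n, ρ * (ρ ^ i * C (j + n - i)) =
        ∑ i ∈ Finset.range n, ρ ^ (i + 1) * C (j + n + 1 - (i + 1)) := by
      refine Finset.sum_congr rfl fun i _ => ?_
      rw [show j + n + 1 - (i + 1) = j + n - i by omega]
      ring
    rw [this]
    simp
    ring

/-- Limits of the second moments of AdaShift at the two active phases. -/
theorem exists_adashift_limits {P : ℕ} (hP : 3 < P) {β : ℝ} (h0 : 0 ≤ β) (h1 : β < 1) :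
    ∃ A B : ℝ, A = β ^ 3 * B + (1 - β) * β ^ 2 ∧
      B = β ^ (P - 3) * A + (1 - β) * (β ^ (P - 4) * ((P : ℝ) / 2) ^ 2) ∧
      ∀ v : ℕ → ℝ, (∀ t, v (t + 1) = β * v t + (1 - β) * sparseGrad P (t + 1) ^ 2) →
        Tendsto (fun k => v (k * P)) atTop (𝓝 A) ∧
        Tendsto (fun k => v (k * P + (P - 3))) atTop (𝓝 B) := by
  have key : ∀ v : ℕ → ℝ, (∀ t, v (t + 1) = β * v t + (1 - β) * sparseGrad P (t + 1) ^ 2) →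
      ∃ A B : ℝ, A = β ^ 3 * B + (1 - β) * β ^ 2 ∧
      B = β ^ (P - 3) * A + (1 - β) * (β ^ (P - 4) * ((P : ℝ) / 2) ^ 2) ∧
        Tendsto (fun k => v (k * P)) atTop (𝓝 A) ∧
        Tendsto (fun k => v (k * P + (P - 3))) atTop (𝓝 B) := by
    intro v hv
    obtain ⟨L, hL, hrec, hper⟩ := exists_periodic_limit (P := P) (by omega) h0 h1
      (C := fun j => (1 - β) * sparseGrad P (j + 1) ^ 2)
      (fun j => by
        simp only [add_assoc, sparseGrad_mul_add]
        exact tendsto_const_nhds) hv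
    refine ⟨L 0, L (P - 3), ?_, ?_, by simpa using hL 0, hL (P - 3)⟩
    · have e1 := hrec (P - 3)
      have e2 := hrec (P - 2)
      have e3 := hrec (P - 1)
      rw [show P - 3 + 1 = P - 2 by omega, sparseGrad_sub_two hP] at e1
      rw [show P - 2 + 1 = P - 1 by omega,
        sparseGrad_eq_zero (by omega) (by omega) (by omega)] at e2
      rw [show P - 1 + 1 = P by omega, sparseGrad_self hP] at e3
      have e4 := hper 0
      rw [zero_add] at e4
      rw [← e4, e3, e2, e1]; ring
    · have e1 := hrec 0
      rw [zero_add, sparseGrad_one hP] at e1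
      have e2 := recurrence_unroll (C := fun j => (1 - β) * sparseGrad P j ^ 2) hrec 1 (P - 4)
      rw [show 1 + (P - 4) = P - 3 by omega, Finset.sum_eq_zero, e1] at e2
      · rw [e2, show P - 3 = P - 4 + 1 by omega, pow_succ]; ring
      · intro i hi
        rw [Finset.mem_range] at hi
        rw [sparseGrad_eq_zero (by omega) (by omega) (by omega)]; simp
  -- A reference sequence started at `0` supplies `A` and `B`. The two equations determine them, so
  -- they serve every run; this is what makes the later `ε₀` independent of `α₀` and `x₀`.
  obtain ⟨A, B, hA, hB, -⟩ := key
    (fun t => Nat.rec 0 (fun t y => β * y + (1 - β) * sparseGrad P (t + 1) ^ 2) t)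
    (fun t => rfl)
  refine ⟨A, B, hA, hB, fun v hv => ?_⟩
  obtain ⟨A', B', hA', hB', h⟩ := key v hv
  have hP1 : β ^ (P - 3) * β ^ 3 < 1 := by
    rw [← pow_add]; exact pow_lt_one₀ h0 h1 (by omega)
  have hAA : (1 - β ^ (P - 3) * β ^ 3) * (A - A') = 0 := by
    rw [hB] at hA; rw [hB'] at hA'; linear_combination hA - hA'
  have hA2 : A = A' := by
    rcases mul_eq_zero.1 hAA with h | h <;> linarith
  have hB2 : B = B' := by rw [hB, hB', hA2]
  rw [hA2, hB2]; exact h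

/-- Limits of the second moments of ACProp at the two active phases, in terms of the limits `m`
and `u` of the first moment right after the two nonzero gradients. -/
theorem exists_acprop_limits {P : ℕ} (hP : 3 < P) {b β : ℝ} (hb0 : 0 ≤ b) (hb1 : b < 1)
    (h0 : 0 ≤ β) (h1 : β < 1) {μ s : ℕ → ℝ}
    (hμ : ∀ t, μ (t + 1) = b * μ t + (1 - b) * sparseGrad P (t + 1))
    (hs : ∀ t, s (t + 1) = β * s t + (1 - β) * (sparseGrad P (t + 1) - μ (t + 1)) ^ 2) :
    ∃ A B m u : ℝ, u = b ^ (P - 3) * m - (1 - b) ∧ m = b ^ 3 * u + (1 - b) * ((P : ℝ) / 2) ∧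
      A = β ^ 3 * B + (1 - β) * ((b ^ 2 * u) ^ 2 + β * (b * u) ^ 2 + β ^ 2 * (1 + u) ^ 2) ∧
      B = β ^ (P - 3) * A + (1 - β) * (β ^ (P - 4) * ((P : ℝ) / 2 - m) ^ 2 +
        ∑ i ∈ Finset.range (P - 4), β ^ i * (b ^ (P - 4 - i) * m) ^ 2) ∧
      Tendsto (fun k => s (k * P)) atTop (𝓝 A) ∧
      Tendsto (fun k => s (k * P + (P - 3))) atTop (𝓝 B) := by
  obtain ⟨M, hM, hMrec, hMper⟩ := exists_periodic_limit (P := P) (by omega) hb0 hb1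
    (C := fun j => (1 - b) * sparseGrad P (j + 1))
    (fun j => by
      simp only [add_assoc, sparseGrad_mul_add]
      exact tendsto_const_nhds) hμ
  obtain ⟨L, hL, hrec, hper⟩ := exists_periodic_limit (P := P) (by omega) h0 h1
    (C := fun j => (1 - β) * (sparseGrad P (j + 1) - M (j + 1)) ^ 2)
    (fun j => by
      simp only [add_assoc, sparseGrad_mul_add]
      exact ((((hM (j + 1)).const_sub _).pow 2).const_mul _)) hs
  have f1 := hMrec 0
  rw [zero_add, sparseGrad_one hP] at f1
  have hMj : ∀ j, j ≤ P - 4 → M (1 + j) = b ^ j * M 1 := by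
    intro j hj
    have e := recurrence_unroll (C := fun j => (1 - b) * sparseGrad P j) hMrec 1 j
    rw [Finset.sum_eq_zero] at e
    · simpa using e
    · intro i hi
      rw [Finset.mem_range] at hi
      rw [sparseGrad_eq_zero (by omega) (by omega) (by omega)]; simp
  have f2 := hMrec (P - 3)
  have f3 := hMrec (P - 2)
  have f4 := hMrec (P - 1)
  have f5 := hMper 0
  rw [show P - 3 + 1 = P - 2 by omega, sparseGrad_sub_two hP] at f2
  rw [show P - 2 + 1 = P - 1 by omega,
    sparseGrad_eq_zero (by omega) (by omega) (by omega)] at f3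
  rw [show P - 1 + 1 = P by omega, sparseGrad_self hP] at f4
  rw [zero_add] at f5
  have f6 := hMj (P - 4) le_rfl
  rw [show 1 + (P - 4) = P - 3 by omega] at f6
  refine ⟨L 0, L (P - 3), M 1, M (P - 2), ?_, ?_, ?_, ?_, by simpa using hL 0, hL (P - 3)⟩
  · rw [f2, f6, show P - 3 = P - 4 + 1 by omega, pow_succ]; ring
  · rw [f1, ← f5, f4, f3]; ring
  · have e1 := hrec (P - 3)
    have e2 := hrec (P - 2)
    have e3 := hrec (P - 1)
    rw [show P - 3 + 1 = P - 2 by omega, sparseGrad_sub_two hP] at e1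
    rw [show P - 2 + 1 = P - 1 by omega,
      sparseGrad_eq_zero (by omega) (by omega) (by omega), f3] at e2
    rw [show P - 1 + 1 = P by omega, sparseGrad_self hP, f4, f3] at e3
    have e4 := hper 0
    rw [zero_add] at e4
    rw [← e4, e3, e2, e1]; ring
  · have e1 := hrec 0
    rw [zero_add, sparseGrad_one hP] at e1
    have e2 := recurrence_unroll (C := fun j => (1 - β) * (sparseGrad P j - M j) ^ 2) hrec 1 (P - 4)
    have e3 : ∑ i ∈ Finset.range (P - 4), β ^ i *
        ((1 - β) * (sparseGrad P (1 + (P - 4) - i) - M (1 + (P - 4) - i)) ^ 2) =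
        (1 - β) * ∑ i ∈ Finset.range (P - 4), β ^ i * (b ^ (P - 4 - i) * M 1) ^ 2 := by
      rw [Finset.mul_sum]
      refine Finset.sum_congr rfl fun i hi => ?_
      rw [Finset.mem_range] at hi
      rw [sparseGrad_eq_zero (by omega) (by omega) (by omega),
        show 1 + (P - 4) - i = 1 + (P - 4 - i) by omega, hMj _ (by omega)]
      ring
    rw [e3, show 1 + (P - 4) = P - 3 by omega, e1] at e2
    rw [e2, show P - 3 = P - 4 + 1 by omega, pow_succ]; ring

/-! ### Inequalities between the ACProp inputs for periods `P ≥ 7`. -/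

/-- Arithmetic-geometric mean inequality for a two-variable geometric sum. -/
theorem card_mul_pow_le_sum (s b : ℝ) (n : ℕ) :
    (n + 1) * (s ^ n * b ^ n) ≤
      ∑ j ∈ Finset.range (n + 1), (s ^ 2) ^ j * (b ^ 2) ^ (n - j) := by
  have hr := Finset.sum_range_reflect (fun j => (s ^ 2) ^ j * (b ^ 2) ^ (n - j)) (n + 1)
  have h2 : 2 * ∑ j ∈ Finset.range (n + 1), (s ^ 2) ^ j * (b ^ 2) ^ (n - j) =
      ∑ j ∈ Finset.range (n + 1),
        ((s ^ 2) ^ j * (b ^ 2) ^ (n - j) + (s ^ 2) ^ (n - j) * (b ^ 2) ^ j) := by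
    rw [Finset.sum_add_distrib, two_mul]
    congr 1
    rw [← hr]
    refine Finset.sum_congr rfl fun j hj => ?_
    rw [Finset.mem_range] at hj
    rw [show n + 1 - 1 - j = n - j by omega, show n - (n - j) = j by omega]
  have h3 : ∑ j ∈ Finset.range (n + 1), 2 * (s ^ n * b ^ n) ≤ ∑ j ∈ Finset.range (n + 1),
        ((s ^ 2) ^ j * (b ^ 2) ^ (n - j) + (s ^ 2) ^ (n - j) * (b ^ 2) ^ j) := by
    refine Finset.sum_le_sum fun j hj => ?_
    rw [Finset.mem_range] at hj
    have e : s ^ n * b ^ n = (s ^ j * b ^ (n - j)) * (s ^ (n - j) * b ^ j) := by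
      have e1 : s ^ n = s ^ j * s ^ (n - j) := by rw [← pow_add]; congr 1; omega
      have e2 : b ^ n = b ^ (n - j) * b ^ j := by rw [← pow_add]; congr 1; omega
      rw [e1, e2]; ring
    rw [e]
    calc _ = 2 * (s ^ j * b ^ (n - j)) * (s ^ (n - j) * b ^ j) := by ring
      _ ≤ _ := two_mul_le_add_sq _ _
      _ = _ := by ring
  rw [Finset.sum_const, Finset.card_range, nsmul_eq_mul] at h3
  push_cast at h3
  linarith

/-- Basic bounds on the limits of the first moment. -/
theorem first_moment_bounds {P : ℕ} (hP : 3 < P) {b m u : ℝ} (hb0 : 0 ≤ b) (hb1 : b < 1)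
    (hu : u = b ^ (P - 3) * m - (1 - b)) (hm : m = b ^ 3 * u + (1 - b) * ((P : ℝ) / 2)) :
    0 < m ∧ (P : ℝ) / 2 - 1 ≤ P * m ∧ 1 - b ≤ m ∧
      u * (1 - b ^ P) = (1 - b) * (b ^ (P - 3) * (P / 2) - 1) := by
  have hbP : b ^ P = b ^ 3 * b ^ (P - 3) := by rw [← pow_add]; congr 1; omega
  have hP4 : (4 : ℝ) ≤ P := by exact_mod_cast hP
  have hlt : b ^ P < 1 := pow_lt_one₀ hb0 hb1 (by omega)
  have hge : 0 ≤ b ^ P := pow_nonneg hb0 _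
  have hb3 : b ^ 3 ≤ 1 := pow_le_one₀ hb0 hb1.le
  have key : m * (1 - b ^ P) = (1 - b) * (P / 2 - b ^ 3) := by
    rw [hbP]; rw [hu] at hm; linear_combination hm
  have hpos : 0 < m := by
    have : 0 < m * (1 - b ^ P) := by
      rw [key]; exact mul_pos (by linarith) (by linarith)
    exact pos_of_mul_pos_left this (by linarith)
  -- Bernoulli's inequality bounds `m = (1 - b) * (P / 2 - b ^ 3) / (1 - b ^ P)` below uniformly in
  -- `b`.
  have hbern : 1 - b ^ P ≤ P * (1 - b) := by
    have := one_add_mul_le_pow (show (-2 : ℝ) ≤ b - 1 by linarith) P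
    rw [add_sub_cancel] at this
    linarith
  refine ⟨hpos, ?_, ?_, ?_⟩
  · have h1 : (1 - b) * (P / 2 - 1) ≤ (1 - b) * (P * m) := by
      calc (1 - b) * ((P : ℝ) / 2 - 1) ≤ (1 - b) * (P / 2 - b ^ 3) :=
            mul_le_mul_of_nonneg_left (by linarith) (by linarith)
        _ = m * (1 - b ^ P) := key.symm
        _ ≤ m * (P * (1 - b)) := mul_le_mul_of_nonneg_left hbern hpos.le
        _ = _ := by ring
    exact le_of_mul_le_mul_left h1 (by linarith)
  · have h1 : m * (1 - b ^ P) ≤ m := by nlinarith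
    have h2 : (1 - b) * 1 ≤ (1 - b) * (P / 2 - b ^ 3) :=
      mul_le_mul_of_nonneg_left (by linarith) (by linarith)
    linarith
  · rw [hbP]; rw [hm] at hu; linear_combination hu

/-- Used with `s = √β` and `P = n + 7`, where `hG` is the square root of the AdaShift condition. For
`n ≥ 5` already `n * m ≥ 2` suffices; for smaller `n`, apart from `n = 0`, `hG` is turned into an
explicit lower bound on `s ^ n`. -/
theorem small_period_bound {n : ℕ} {s m : ℝ} (hs : 0 < s) (hs1 : s ≤ 1)
    (hm : ((n + 7 : ℕ) : ℝ) / 2 - 1 ≤ (n + 7 : ℕ) * m)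
    (hG : 1 ≤ (((n + 7 : ℕ) : ℝ) / 2) ^ 2 * s ^ (n + 1)) :
    2 + m ≤ (((n + 7 : ℕ) : ℝ) / 2) ^ 2 * m * ((n + 1) * s ^ n) := by
  have hm0 : 0 ≤ m := by
    by_contra! h
    push_cast at hm
    nlinarith [Nat.cast_nonneg (α := ℝ) n]
  rcases Nat.lt_or_ge n 5 with h | h
  · interval_cases n
    · norm_num at *; linarith
    · norm_num at *
      nlinarith
    · norm_num at *
      have : 1 / 3 ≤ s := by
        by_contra! h; nlinarith [pow_lt_pow_left₀ h hs.le (show 3 ≠ 0 by norm_num)]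
      have : (1 / 9 : ℝ) ≤ s ^ 2 := by nlinarith
      nlinarith
    · norm_num at *
      have : (3 / 50 : ℝ) ≤ s ^ 3 := by
        rcases le_total s (3 / 5) with h | h
        · nlinarith [pow_pos hs 3]
        · nlinarith [pow_le_pow_left₀ (by norm_num) h 3]
      nlinarith
    · norm_num at *
      have : (1 / 25 : ℝ) ≤ s ^ 4 := by
        rcases le_total s (4 / 5) with h | h
        · nlinarith [pow_pos hs 4]
        · nlinarith [pow_le_pow_left₀ (by norm_num) h 4]
      nlinarith
  · have hn : (5 : ℝ) ≤ n := by exact_mod_cast h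
    have h1 : 1 ≤ (((n + 7 : ℕ) : ℝ) / 2) ^ 2 * s ^ n :=
      hG.trans (mul_le_mul_of_nonneg_left (pow_le_pow_of_le_one hs.le hs1 (by omega))
        (by positivity))
    have h2 : 2 ≤ n * m := by
      push_cast at hm
      have : 0 < (n : ℝ) + 7 := by positivity
      have h3 : 2 * ((n : ℝ) + 7) ≤ n * m * (n + 7) := by nlinarith
      exact le_of_mul_le_mul_right h3 this
    calc 2 + m ≤ m * (n + 1) * 1 := by linarith
      _ ≤ m * (n + 1) * ((((n + 7 : ℕ) : ℝ) / 2) ^ 2 * s ^ n) :=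
        mul_le_mul_of_nonneg_left h1 (by positivity)
      _ = _ := by ring

/-- The case of a positive limit of the first moment after the gradient `-1`. -/
theorem moment_ineq_of_pos {G b β h u : ℝ} (hG : 3 ≤ G) (hb0 : 0 ≤ b) (hb1 : b ≤ 1)
    (hβ0 : 0 ≤ β) (hβ1 : β ≤ 1) (hu : 0 ≤ u) (huh : u ≤ h) (hh : G - 1 ≤ 2 * G ^ 2 * h) :
    G ^ 2 * (u ^ 2 * (b ^ 4 + β * b ^ 2) + β ^ 2 * (b + h) ^ 2) ≤
      β ^ 2 * b ^ 2 * (G - b ^ 2 * u) ^ 2 + G ^ 4 * (h ^ 2 * (1 + β + β ^ 2)) := by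
  have hh0 : 0 ≤ h := hu.trans huh
  have hb2 : b ^ 2 ≤ 1 := pow_le_one₀ hb0 hb1
  have hb3 : b ^ 3 ≤ 1 := pow_le_one₀ hb0 hb1
  have hb4 : b ^ 4 ≤ 1 := pow_le_one₀ hb0 hb1
  have huh2 : u ^ 2 ≤ h ^ 2 := pow_le_pow_left₀ hu huh 2
  have e1 : u ^ 2 * (b ^ 4 + β * b ^ 2) ≤ h ^ 2 * (1 + β) :=
    mul_le_mul huh2 (by nlinarith) (by positivity) (by positivity)
  have hk : b ^ 3 * u ≤ h := by nlinarith [mul_le_mul hb3 huh hu zero_le_one]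
  have hk0 : 0 ≤ b ^ 3 * u := by positivity
  -- The terms `G ^ 2 * b ^ 2` cancel. The remainder has a part linear in `h`, which the lower bound
  -- `hh` absorbs into a multiple of `h ^ 2` in `e3`.
  have e2 : G ^ 2 * (b + h) ^ 2 - b ^ 2 * (G - b ^ 2 * u) ^ 2 ≤
      2 * (G * (G + 1)) * h + G ^ 2 * h ^ 2 := by
    have : G ^ 2 * (b + h) ^ 2 - b ^ 2 * (G - b ^ 2 * u) ^ 2 =
      2 * G * (b * (G * h + b ^ 3 * u)) + G ^ 2 * h ^ 2 - (b ^ 3 * u) ^ 2 := by ring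
    have h3 : b * (G * h + b ^ 3 * u) ≤ 1 * (G * h + h) :=
      mul_le_mul hb1 (by linarith) (by positivity) zero_le_one
    nlinarith [sq_nonneg (b ^ 3 * u)]
  have e3 : 2 * (G * (G + 1)) * h + G ^ 2 * h ^ 2 ≤
      2 * (G ^ 4 - G ^ 2) * h ^ 2 + G ^ 4 * h ^ 2 := by
    have : 2 * (G + 1) ≤ 3 * (G ^ 2 - 1) * (G * h) := by
      have h1 : 4 * G ≤ 3 * (G - 1) ^ 2 := by nlinarith
      have h2 : 4 * G ≤ 3 * (G - 1) * (2 * G ^ 2 * h) := by nlinarith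
      have h3 : 2 ≤ 3 * (G - 1) * (G * h) := by nlinarith
      nlinarith
    have h4 := mul_le_mul_of_nonneg_right this (mul_nonneg (by linarith : 0 ≤ G) hh0)
    nlinarith
  have hβ2 : β ^ 2 ≤ 1 := pow_le_one₀ hβ0 hβ1
  have hβ2' : β ^ 2 ≤ β := by nlinarith
  have e4 := mul_le_mul_of_nonneg_left (e2.trans e3) (sq_nonneg β)
  have e5 : 0 ≤ (G ^ 4 - G ^ 2) * h ^ 2 := by
    have : 0 ≤ G ^ 4 - G ^ 2 := by nlinarith [sq_nonneg G]
    positivity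
  have e6 : β ^ 2 * (2 * ((G ^ 4 - G ^ 2) * h ^ 2)) ≤ (1 + β) * ((G ^ 4 - G ^ 2) * h ^ 2) := by
    nlinarith
  have e7 := mul_le_mul_of_nonneg_left e1 (sq_nonneg G)
  nlinarith

/-- This is the extreme case `w = 1 - b` in `moment_ineq_of_le`. The constants come from `1 / 2 + 39
/ 100 = 89 / 100` and, as `a * b ^ 2 ≤ 4 / 27`, from `1 / 2 + 4 / 27 * (27 / 8) = 1`. -/
theorem cubic_bound {a b β : ℝ} (ha : a = 1 - b) (ha0 : 0 ≤ a) (hb0 : 0 ≤ b)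
    (hβ0 : 0 ≤ β) (hβ1 : β ≤ 1) :
    a * (β ^ 2 * b + β * b ^ 3) ≤ β ^ 3 + 89 / 100 * a * b ^ 2 := by
  have ha1 : a ≤ 1 := by linarith
  have hb1 : b ≤ 1 := by linarith
  have h1 : β ^ 2 * b ≤ b ^ 2 / 2 + β ^ 4 / 2 := by nlinarith [sq_nonneg (b - β ^ 2)]
  have h2 : a * β ^ 4 ≤ β ^ 3 := by
    have : β ^ 4 ≤ β ^ 3 := pow_le_pow_of_le_one hβ0 hβ1 (by norm_num)
    nlinarith [pow_nonneg hβ0 4]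
  have h3 : a * b ^ 2 ≤ 4 / 27 := by
    rw [ha]; nlinarith [mul_nonneg (by linarith : 0 ≤ 3 * b + 1) (sq_nonneg (3 * b - 2))]
  have h4 : β * b ≤ 39 / 100 + 27 / 8 * β ^ 3 := by
    have : β * b ≤ β := by nlinarith
    have : β ≤ 39 / 100 + 27 / 8 * β ^ 3 := by
      nlinarith [mul_nonneg (by linarith : 0 ≤ β + 2 / 3) (sq_nonneg (β - 1 / 3)), sq_nonneg β]
    linarith
  have h5 : 0 ≤ a * b ^ 2 := by positivity
  have h6 := mul_le_mul_of_nonneg_left h4 h5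
  have h7 : a * b ^ 2 * β ^ 3 ≤ 4 / 27 * β ^ 3 :=
    mul_le_mul_of_nonneg_right h3 (by positivity)
  have h8 := mul_le_mul_of_nonneg_left h1 ha0
  nlinarith

/-- The case `G h ≤ b ^ 3 w` of the comparison of the second moments. -/
theorem moment_ineq_of_le {G b β h w m : ℝ} (hG : 7 / 2 ≤ G) (hb0 : 0 ≤ b) (hb1 : b ≤ 1)
    (hβ0 : 0 ≤ β) (hβ1 : β ≤ 1) (hh : 0 ≤ h) (hw : 0 ≤ w) (hwh : w = 1 - b - h)
    (hm : m = (1 - b) * G - b ^ 3 * w) (hd : G * h ≤ b ^ 3 * w) :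
    G ^ 2 * β * (w ^ 2 * (b ^ 4 + β * b ^ 2) + β ^ 2 * (b + h) ^ 2) ≤
      β ^ 3 * (b * (G + b ^ 2 * w)) ^ 2 +
        m ^ 2 * (β ^ 2 * b ^ 2 + β * b ^ 4 + b ^ 6) := by
  obtain ⟨d, hd'⟩ : ∃ d, d = b ^ 3 * w - G * h := ⟨_, rfl⟩
  have hd0 : 0 ≤ d := by linarith
  have hb3 : b ^ 3 ≤ 1 := pow_le_one₀ hb0 hb1
  have hdle : d ≤ b ^ 3 * w := by nlinarith
  have hdw : d ≤ w := by nlinarith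
  have hmw : m = G * w - d := by rw [hm, hd', hwh]; ring
  -- In terms of the slack `d`, the difference of the two sides is `d` times a bracket plus the
  -- square `m ^ 2 * b ^ 6`. Only a negative bracket can hurt, and then the largest value `d = b ^ 3
  -- * w` is the worst.
  have hid : β ^ 3 * (b * (G + b ^ 2 * w)) ^ 2 + m ^ 2 * (β ^ 2 * b ^ 2 + β * b ^ 4 + b ^ 6) -
      G ^ 2 * β * (w ^ 2 * (b ^ 4 + β * b ^ 2) + β ^ 2 * (b + h) ^ 2) =
      d * (β ^ 3 * (2 * G * b + b ^ 3 * w + G * h) -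
        (β ^ 2 * b ^ 2 + β * b ^ 4) * (m + G * w)) + m ^ 2 * b ^ 6 := by
    rw [hmw, hd']; ring
  have hm1 : ((G - 1) * w) ^ 2 ≤ m ^ 2 :=
    pow_le_pow_left₀ (mul_nonneg (by linarith) hw) (by rw [hmw]; linarith) 2
  have hbr : β ^ 3 * (2 * G * b) - (β ^ 2 * b ^ 2 + β * b ^ 4) * (2 * G * w) ≤
      β ^ 3 * (2 * G * b + b ^ 3 * w + G * h) - (β ^ 2 * b ^ 2 + β * b ^ 4) * (m + G * w) := by
    have h1 : (β ^ 2 * b ^ 2 + β * b ^ 4) * (m + G * w) ≤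
        (β ^ 2 * b ^ 2 + β * b ^ 4) * (2 * G * w) :=
      mul_le_mul_of_nonneg_left (by rw [hmw]; linarith) (by positivity)
    have h2 : 0 ≤ β ^ 3 * (b ^ 3 * w + G * h) := by
      have : 0 ≤ G * h := mul_nonneg (by linarith) hh
      positivity
    linarith
  set X := β ^ 3 * (2 * G * b) - (β ^ 2 * b ^ 2 + β * b ^ 4) * (2 * G * w) with hX
  have hmain : 0 ≤ d * X + ((G - 1) * w) ^ 2 * b ^ 6 := by
    rcases le_total 0 X with h0 | h0
    · positivity
    · have h1 : b ^ 3 * w * X ≤ d * X := mul_le_mul_of_nonpos_right hdle h0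
      have hcub := cubic_bound (a := 1 - b) rfl (by linarith) hb0 hβ0 hβ1
      -- Here `178 / 100` is twice the constant of `cubic_bound`; at `G = 7 / 2` the quotient `(G -
      -- 1) ^ 2 / G` is `25 / 14`, barely above it.
      have hG2 : 178 / 100 * G ≤ (G - 1) ^ 2 := by nlinarith
      have hwa : w ≤ 1 - b := by linarith
      have h2 : 0 ≤ 2 * β ^ 3 - 2 * w * (β ^ 2 * b + β * b ^ 3) + 178 / 100 * w * b ^ 2 := by
        -- The expression is affine in `w` on `[0, 1 - b]`, so the sign of its slope tells which
        -- endpoint is the worst.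
        rcases le_total (β ^ 2 * b + β * b ^ 3) (89 / 100 * b ^ 2) with h3 | h3
        · have := mul_le_mul_of_nonneg_left h3 hw
          have : 0 ≤ β ^ 3 := by positivity
          linarith
        · have := mul_le_mul_of_nonneg_right hwa (sub_nonneg.2 h3)
          linarith
      have h3 : 0 ≤ 2 * G * β ^ 3 - 2 * G * w * (β ^ 2 * b + β * b ^ 3) +
          (G - 1) ^ 2 * w * b ^ 2 := by
        have h4 := mul_nonneg (by linarith : 0 ≤ G) h2
        have h5 := mul_le_mul_of_nonneg_right hG2 (by positivity : 0 ≤ w * b ^ 2)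
        linarith
      have h4 : b ^ 3 * w * X + ((G - 1) * w) ^ 2 * b ^ 6 = w * b ^ 4 *
          (2 * G * β ^ 3 - 2 * G * w * (β ^ 2 * b + β * b ^ 3) + (G - 1) ^ 2 * w * b ^ 2) := by
        rw [hX]; ring
      have h5 : 0 ≤ w * b ^ 4 *
          (2 * G * β ^ 3 - 2 * G * w * (β ^ 2 * b + β * b ^ 3) + (G - 1) ^ 2 * w * b ^ 2) :=
        mul_nonneg (by positivity) h3
      linarith
  have h1 := mul_le_mul_of_nonneg_left hbr hd0
  have h2 := mul_le_mul_of_nonneg_right hm1 (by positivity : 0 ≤ b ^ 6)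
  linarith

/-- The left side is the input to `A` after the gradient `-1`, the right side `G ^ 2` times the
input to `B` after the gradient `G`. Put `h = b ^ (P - 3) * m`, so `u = h - (1 - b)`. If `u ≥ 0`,
then `b ^ (P - 3) * G ≥ 1`, so `h` is not small and the three latest terms of the sum suffice. If `u
= -w ≤ 0` and `G * h ≤ b ^ 3 * w`, the three earliest terms suffice. Otherwise the inequality holds
piece by piece, the excess `2 * b * h + h ^ 2` being paid for by the arithmetic-geometric mean
inequality over the remaining terms. -/
theorem moment_ineq_large {n : ℕ} {G b β m u : ℝ} (hG : G = ((n + 7 : ℕ) : ℝ) / 2)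
    (hb0 : 0 ≤ b) (hb1 : b < 1) (hβ0 : 0 < β) (hβ1 : β < 1)
    (hu : u = b ^ (n + 4) * m - (1 - b)) (hm : m = b ^ 3 * u + (1 - b) * G)
    (hAda : 1 ≤ G ^ 4 * β ^ (n + 1)) :
    (b ^ 2 * u) ^ 2 + β * (b * u) ^ 2 + β ^ 2 * (1 + u) ^ 2 ≤
      G ^ 2 * (β ^ (n + 3) * (G - m) ^ 2 +
        ∑ i ∈ Finset.range (n + 3), β ^ i * (b ^ (n + 3 - i) * m) ^ 2) := by
  have hG7 : 7 / 2 ≤ G := by rw [hG]; push_cast; linarith [Nat.cast_nonneg (α := ℝ) n]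
  obtain ⟨hm0, hPm, -, huP⟩ := first_moment_bounds (P := n + 7) (by omega) hb0 hb1 hu
    (by rw [← hG]; exact hm)
  rw [← hG] at huP
  change u * (1 - b ^ (n + 7)) = (1 - b) * (b ^ (n + 4) * G - 1) at huP
  obtain ⟨h, hh⟩ : ∃ h, h = b ^ (n + 4) * m := ⟨_, rfl⟩
  have hh0 : 0 ≤ h := by rw [hh]; positivity
  have hR : (b ^ 2 * u) ^ 2 + β * (b * u) ^ 2 + β ^ 2 * (1 + u) ^ 2 =
      u ^ 2 * (b ^ 4 + β * b ^ 2) + β ^ 2 * (b + h) ^ 2 := by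
    rw [show 1 + u = b + h by rw [hu, hh]; ring]; ring
  have hGm : G - m = b * (G - b ^ 2 * u) := by rw [hm]; ring
  -- The AdaShift condition compensates the decay `β ^ (n + 1)` of the oldest input.
  have hlead : β ^ 2 * (G - m) ^ 2 ≤ G ^ 4 * (β ^ (n + 3) * (G - m) ^ 2) := by
    have := mul_le_mul_of_nonneg_right hAda (by positivity : 0 ≤ β ^ 2 * (G - m) ^ 2)
    calc _ = 1 * (β ^ 2 * (G - m) ^ 2) := (one_mul _).symm
      _ ≤ _ := this
      _ = _ := by ring
  have hterm : ∀ i, 0 ≤ β ^ i * (b ^ (n + 3 - i) * m) ^ 2 := fun i => by positivity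
  have hGpos : 0 < G ^ 2 := by positivity
  rw [hR]
  rcases le_total 0 u with hu0 | hu0
  · have hbP : 1 ≤ b ^ (n + 4) * G := by
      by_contra! hlt
      have h1 : 0 ≤ u * (1 - b ^ (n + 7)) :=
        mul_nonneg hu0 (sub_nonneg.2 (pow_le_one₀ hb0 hb1.le))
      nlinarith
    have hlow : G - 1 ≤ 2 * G ^ 2 * h := by
      have h1 : G - 1 ≤ 2 * G * m := by rw [hG] at *; linarith
      calc G - 1 ≤ 2 * G * m * 1 := by linarith
        _ ≤ 2 * G * m * (b ^ (n + 4) * G) :=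
          mul_le_mul_of_nonneg_left hbP (by positivity)
        _ = _ := by rw [hh]; ring
    have hmain := moment_ineq_of_pos (by linarith) hb0 hb1.le hβ0.le hβ1.le hu0
      (by rw [hu, hh]; linarith : u ≤ h) hlow
    have hsum : h ^ 2 * (1 + β + β ^ 2) ≤
        ∑ i ∈ Finset.range (n + 3), β ^ i * (b ^ (n + 3 - i) * m) ^ 2 := by
      have hle : ∀ i, i ≤ n + 3 → h ^ 2 ≤ (b ^ (n + 3 - i) * m) ^ 2 := fun i _ => by
        rw [hh]
        exact pow_le_pow_left₀ (by positivity) (mul_le_mul_of_nonneg_right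
          (pow_le_pow_of_le_one hb0 hb1.le (by omega)) hm0.le) 2
      have hsub : ∑ i ∈ Finset.range 3, β ^ i * (b ^ (n + 3 - i) * m) ^ 2 ≤
          ∑ i ∈ Finset.range (n + 3), β ^ i * (b ^ (n + 3 - i) * m) ^ 2 :=
        Finset.sum_le_sum_of_subset_of_nonneg
          (Finset.range_mono (by omega)) (fun i _ _ => hterm i)
      refine le_trans ?_ hsub
      calc h ^ 2 * (1 + β + β ^ 2) = ∑ i ∈ Finset.range 3, β ^ i * h ^ 2 := by
            simp [Finset.sum_range_succ]; ring
        _ ≤ _ := Finset.sum_le_sum fun i hi => mul_le_mul_of_nonneg_left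
            (hle i (by have := Finset.mem_range.1 hi; omega)) (by positivity)
    have h1 := mul_le_mul_of_nonneg_left hsum (by positivity : 0 ≤ G ^ 4)
    rw [hGm] at hlead ⊢
    refine le_of_mul_le_mul_left ?_ hGpos
    linarith
  · obtain ⟨w, hw⟩ : ∃ w, w = -u := ⟨_, rfl⟩
    have hw0 : 0 ≤ w := by linarith
    have huw : u = -w := by linarith
    have hGm' : G - m = b * (G + b ^ 2 * w) := by rw [hGm, huw]; ring
    rw [show u ^ 2 = w ^ 2 by rw [huw]; ring]
    rcases le_or_gt (G * h) (b ^ 3 * w) with hd | hd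
    · have hmain := moment_ineq_of_le hG7 hb0 hb1.le hβ0.le hβ1.le hh0 hw0
        (by rw [hw, hu, hh]; ring : w = 1 - b - h)
        (by rw [huw] at hm; linarith : m = (1 - b) * G - b ^ 3 * w) hd
      have hsum : β ^ n * (m ^ 2 * (β ^ 2 * b ^ 2 + β * b ^ 4 + b ^ 6)) ≤
          ∑ i ∈ Finset.range (n + 3), β ^ i * (b ^ (n + 3 - i) * m) ^ 2 := by
        rw [Finset.sum_range_succ, Finset.sum_range_succ, Finset.sum_range_succ,
          show n + 3 - (n + 2) = 1 by omega, show n + 3 - (n + 1) = 2 by omega,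
          show n + 3 - n = 3 by omega]
        have : 0 ≤ ∑ i ∈ Finset.range n, β ^ i * (b ^ (n + 3 - i) * m) ^ 2 :=
          Finset.sum_nonneg fun i _ => hterm i
        have e : β ^ n * (m ^ 2 * (β ^ 2 * b ^ 2 + β * b ^ 4 + b ^ 6)) =
          β ^ n * (b ^ 3 * m) ^ 2 + β ^ (n + 1) * (b ^ 2 * m) ^ 2 +
            β ^ (n + 2) * (b ^ 1 * m) ^ 2 := by ring
        linarith
      set R := w ^ 2 * (b ^ 4 + β * b ^ 2) + β ^ 2 * (b + h) ^ 2 with hRdef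
      have hR0 : 0 ≤ R := by positivity
      have h1 := mul_le_mul_of_nonneg_left hmain (by positivity : 0 ≤ β ^ n)
      rw [← hGm'] at h1
      have h2 : G ^ 2 * β ^ (n + 1) * R ≤ β ^ (n + 3) * (G - m) ^ 2 +
          ∑ i ∈ Finset.range (n + 3), β ^ i * (b ^ (n + 3 - i) * m) ^ 2 := by
        calc _ = β ^ n * (G ^ 2 * β * R) := by ring
          _ ≤ _ := h1
          _ = β ^ (n + 3) * (G - m) ^ 2 +
            β ^ n * (m ^ 2 * (β ^ 2 * b ^ 2 + β * b ^ 4 + b ^ 6)) := by ring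
          _ ≤ _ := add_le_add le_rfl hsum
      calc R = 1 * R := (one_mul R).symm
        _ ≤ (G ^ 4 * β ^ (n + 1)) * R := mul_le_mul_of_nonneg_right hAda hR0
        _ = G ^ 2 * (G ^ 2 * β ^ (n + 1) * R) := by ring
        _ ≤ _ := mul_le_mul_of_nonneg_left h2 hGpos.le
    · have hbpos : 0 < b := by
        rcases hb0.eq_or_lt with h0 | h0
        · rw [hh, ← h0] at hd; simp at hd
        · exact h0
      have e1 : (b ^ 2 * w) ^ 2 ≤ G ^ 2 * (b ^ (n + 3) * m) ^ 2 := by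
        rw [← mul_pow]
        refine pow_le_pow_left₀ (by positivity) (le_of_mul_le_mul_right ?_ hbpos) 2
        rw [hh] at hd
        calc b ^ 2 * w * b = b ^ 3 * w := by ring
          _ ≤ _ := hd.le
          _ = _ := by ring
      have e2 : (b * w) ^ 2 ≤ G ^ 2 * (b ^ (n + 2) * m) ^ 2 := by
        rw [← mul_pow]
        refine pow_le_pow_left₀ (by positivity)
          (le_of_mul_le_mul_right ?_ (pow_pos hbpos 2)) 2
        rw [hh] at hd
        calc b * w * b ^ 2 = b ^ 3 * w := by ring
          _ ≤ _ := hd.le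
          _ = _ := by ring
      have e3 : β ^ 2 * b ^ 2 ≤ G ^ 2 * (β ^ (n + 3) * (G - m) ^ 2) := by
        refine le_of_mul_le_mul_left ?_ hGpos
        have h1 : (b * G) ^ 2 ≤ (G - m) ^ 2 := by
          rw [hGm']
          exact pow_le_pow_left₀ (by positivity)
            (mul_le_mul_of_nonneg_left (by linarith [mul_nonneg (sq_nonneg b) hw0]) hb0) 2
        calc G ^ 2 * (β ^ 2 * b ^ 2) = β ^ 2 * (b * G) ^ 2 := by ring
          _ ≤ β ^ 2 * (G - m) ^ 2 := mul_le_mul_of_nonneg_left h1 (sq_nonneg β)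
          _ ≤ _ := hlead
          _ = _ := by ring
      have e4 : 2 * b * h + h ^ 2 ≤
          G ^ 2 * ∑ j ∈ Finset.range (n + 1), β ^ j * (b ^ (n + 1 - j) * m) ^ 2 := by
        have hs0 : 0 < √β := Real.sqrt_pos.2 hβ0
        have hs2 : √β ^ 2 = β := Real.sq_sqrt hβ0.le
        have hs1 : √β ≤ 1 := Real.sqrt_le_one.2 hβ1.le
        have hGs : 1 ≤ G ^ 2 * √β ^ (n + 1) := by
          have : 1 ≤ (G ^ 2 * √β ^ (n + 1)) ^ 2 := by
            rw [mul_pow, ← pow_mul, ← pow_mul, mul_comm (n + 1) 2, pow_mul √β, hs2]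
            exact hAda
          exact (one_le_sq_iff₀ (by positivity)).1 this
        have h1 := small_period_bound hs0 hs1 hPm (by rw [← hG]; exact hGs)
        rw [← hG] at h1
        have h2 := card_mul_pow_le_sum √β b n
        rw [hs2] at h2
        have h3 : ∑ j ∈ Finset.range (n + 1), β ^ j * (b ^ (n + 1 - j) * m) ^ 2 =
            (b * m) ^ 2 * ∑ j ∈ Finset.range (n + 1), β ^ j * (b ^ 2) ^ (n - j) := by
          rw [Finset.mul_sum]
          refine Finset.sum_congr rfl fun j hj => ?_
          rw [Finset.mem_range] at hj
          rw [show n + 1 - j = n - j + 1 by omega]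
          ring
        rw [h3]
        have h4 : b ^ (n + 5) ≤ b ^ (n + 2) := pow_le_pow_of_le_one hb0 hb1.le (by omega)
        have h5 : b ^ (2 * n + 8) ≤ b ^ (n + 2) := pow_le_pow_of_le_one hb0 hb1.le (by omega)
        calc 2 * b * h + h ^ 2 = m * (2 * b ^ (n + 5) + b ^ (2 * n + 8) * m) := by rw [hh]; ring
          _ ≤ m * (2 * b ^ (n + 2) + b ^ (n + 2) * m) := by gcongr
          _ = m * b ^ (n + 2) * (2 + m) := by ring
          _ ≤ m * b ^ (n + 2) * (G ^ 2 * m * ((n + 1) * √β ^ n)) := by gcongr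
          _ = G ^ 2 * ((b * m) ^ 2 * ((n + 1) * (√β ^ n * b ^ n))) := by ring
          _ ≤ _ := by gcongr
      have hsplit : ∑ i ∈ Finset.range (n + 3), β ^ i * (b ^ (n + 3 - i) * m) ^ 2 =
          (b ^ (n + 3) * m) ^ 2 + β * (b ^ (n + 2) * m) ^ 2 +
            β ^ 2 * ∑ j ∈ Finset.range (n + 1), β ^ j * (b ^ (n + 1 - j) * m) ^ 2 := by
        rw [Finset.sum_range_succ', Finset.sum_range_succ', Finset.mul_sum]
        have : ∑ k ∈ Finset.range (n + 1), β ^ (k + 1 + 1) * (b ^ (n + 3 - (k + 1 + 1)) * m) ^ 2 =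
            ∑ k ∈ Finset.range (n + 1), β ^ 2 * (β ^ k * (b ^ (n + 1 - k) * m) ^ 2) := by
          refine Finset.sum_congr rfl fun k _ => ?_
          rw [show n + 3 - (k + 1 + 1) = n + 1 - k by omega]
          ring
        rw [this, show n + 3 - (0 + 1) = n + 2 by omega, show n + 3 - 0 = n + 3 by omega]
        ring
      rw [hsplit]
      have f2 := mul_le_mul_of_nonneg_left e2 hβ0.le
      have f4 := mul_le_mul_of_nonneg_left e4 (sq_nonneg β)
      linarith

/-! ### The short periods `P = 4, 5, 6`, where the AdaShift condition is automatic. -/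

/-- The factor `1 - 4 * β` must be kept: it settles `β ≥ 1 / 4`. For smaller `β`, both `1 + u` and
`2 - m` are multiples of `b`, and after division by `b ^ 2` both sides are compared with `3`. -/
theorem moment_ineq_four {b β m u : ℝ} (hb0 : 0 ≤ b) (hb1 : b < 1) (hβ0 : 0 < β) (hβ1 : β < 1)
    (hu : u = b * m - (1 - b)) (hm : m = b ^ 3 * u + (1 - b) * 2) (hm0 : 0 < m) :
    (1 - 4 * β) * ((b ^ 2 * u) ^ 2 + β * (b * u) ^ 2 + β ^ 2 * (1 + u) ^ 2) ≤
      (4 - β ^ 3) * (2 - m) ^ 2 := by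
  have hβ3 : β ^ 3 ≤ 1 := pow_le_one₀ hβ0.le hβ1.le
  rcases le_total (1 / 4) β with h | h
  · have h1 : 0 ≤ (b ^ 2 * u) ^ 2 + β * (b * u) ^ 2 + β ^ 2 * (1 + u) ^ 2 := by positivity
    have h2 : 0 ≤ (4 - β ^ 3) * (2 - m) ^ 2 := mul_nonneg (by linarith) (sq_nonneg _)
    nlinarith
  · have hu1 : -1 ≤ u := by nlinarith
    have hb3 : b ^ 3 ≤ 1 := pow_le_one₀ hb0 hb1.le
    have hb2 : b ^ 2 ≤ 1 := pow_le_one₀ hb0 hb1.le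
    have hb4 : b ^ 4 < 1 := pow_lt_one₀ hb0 hb1 (by norm_num)
    have hu2 : u ≤ 1 := by
      by_contra! hlt
      have h1 : u * (1 - b ^ 4) = (1 - b) * (2 * b - 1) := by
        rw [hm] at hu; linear_combination hu
      have h2 : (1 - b) * (2 * b - 1) ≤ 1 - b ^ 4 := by
        nlinarith [mul_nonneg (sub_nonneg.2 hb1.le) (show 0 ≤ b ^ 3 + b ^ 2 - b + 2 by nlinarith [pow_nonneg hb0 3, sq_nonneg b])]
      nlinarith
    have hm2 : m ≤ 2 := by nlinarith [pow_nonneg hb0 3]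
    have e : 2 - m = b * (2 - b ^ 2 * u) := by rw [hm]; ring
    have e1 : 1 + u = b * (1 + m) := by rw [hu]; ring
    have hu3 : u ^ 2 ≤ 1 := by nlinarith
    have h1 : 1 ≤ (2 - b ^ 2 * u) ^ 2 := by
      have : 1 ≤ 2 - b ^ 2 * u := by nlinarith [sq_nonneg b]
      nlinarith
    have h2 : (1 + m) ^ 2 ≤ 9 := by nlinarith
    have h3 : (b ^ 2 * u) ^ 2 + β * (b * u) ^ 2 + β ^ 2 * (1 + u) ^ 2 ≤ b ^ 2 * 3 := by
      rw [e1, show (b ^ 2 * u) ^ 2 + β * (b * u) ^ 2 + β ^ 2 * (b * (1 + m)) ^ 2 =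
        b ^ 2 * ((b ^ 2 + β) * u ^ 2 + β ^ 2 * (1 + m) ^ 2) by ring]
      refine mul_le_mul_of_nonneg_left ?_ (sq_nonneg b)
      have : (b ^ 2 + β) * u ^ 2 ≤ 5 / 4 * 1 :=
        mul_le_mul (by linarith) hu3 (sq_nonneg u) (by norm_num)
      have : β ^ 2 * (1 + m) ^ 2 ≤ 1 / 16 * 9 :=
        mul_le_mul (by nlinarith) h2 (sq_nonneg _) (by norm_num)
      linarith
    calc _ ≤ (b ^ 2 * u) ^ 2 + β * (b * u) ^ 2 + β ^ 2 * (1 + u) ^ 2 := by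
          have : 0 ≤ (b ^ 2 * u) ^ 2 + β * (b * u) ^ 2 + β ^ 2 * (1 + u) ^ 2 := by positivity
          nlinarith
      _ ≤ b ^ 2 * 3 := h3
      _ ≤ b ^ 2 * ((4 - β ^ 3) * (2 - b ^ 2 * u) ^ 2) := by
          refine mul_le_mul_of_nonneg_left ?_ (sq_nonneg b)
          nlinarith
      _ = _ := by rw [e]; ring

/-- A factor `b ^ 2` comes out of both sides; the rest follows from `|u| ≤ 1` and `|u| ≤ m`. The
constant `5` is a lower bound for `(5 / 2) ^ 2 - β ^ 3`. -/
theorem moment_ineq_five {b β m u : ℝ} (hb0 : 0 ≤ b) (hb1 : b < 1) (hβ0 : 0 < β) (hβ1 : β < 1)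
    (hu : u = b ^ 2 * m - (1 - b)) (hm : m = b ^ 3 * u + (1 - b) * (5 / 2)) (hm0 : 0 < m)
    (hbm : 1 - b ≤ m) :
    (b ^ 2 * u) ^ 2 + β * (b * u) ^ 2 + β ^ 2 * (1 + u) ^ 2 ≤
      5 * (β * (5 / 2 - m) ^ 2 + (b * m) ^ 2) := by
  have hb2 : b ^ 2 ≤ 1 := pow_le_one₀ hb0 hb1.le
  have hb3 : b ^ 3 ≤ 1 := pow_le_one₀ hb0 hb1.le
  have hum : u ≤ m := by nlinarith
  have hu1 : -1 ≤ u := by nlinarith [sq_nonneg b]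
  have hu1' : -m ≤ u := by nlinarith [sq_nonneg b]
  have hu2 : u ≤ 1 := by
    by_contra! hlt
    have h1 : u * (1 - b ^ 5) = (1 - b) * (5 / 2 * b ^ 2 - 1) := by
      rw [hm] at hu; linear_combination hu
    have h2 : (1 - b) * (5 / 2 * b ^ 2 - 1) ≤ 1 - b ^ 5 := by
      nlinarith [mul_nonneg (sub_nonneg.2 hb1.le)
        (show 0 ≤ b ^ 4 + b ^ 3 + b - 3 / 2 * b ^ 2 + 2 by
          nlinarith [pow_nonneg hb0 3, pow_nonneg hb0 4])]
    have h3 : b ^ 5 < 1 := pow_lt_one₀ hb0 hb1 (by norm_num)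
    nlinarith
  have e : 5 / 2 - m = b * (5 / 2 - b ^ 2 * u) := by rw [hm]; ring
  have e1 : 1 + u = b * (1 + b * m) := by rw [hu]; ring
  have hu3 : u ^ 2 ≤ 1 := by nlinarith
  have hu4 : u ^ 2 ≤ m ^ 2 := by nlinarith
  have h1 : 1 ≤ (5 / 2 - b ^ 2 * u) ^ 2 := by
    have : 1 ≤ 5 / 2 - b ^ 2 * u := by nlinarith [sq_nonneg b]
    nlinarith
  rw [e1, e, show (b ^ 2 * u) ^ 2 + β * (b * u) ^ 2 + β ^ 2 * (b * (1 + b * m)) ^ 2 =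
      b ^ 2 * (b ^ 2 * u ^ 2 + β * u ^ 2 + β ^ 2 * (1 + b * m) ^ 2) by ring,
    show 5 * (β * (b * (5 / 2 - b ^ 2 * u)) ^ 2 + (b * m) ^ 2) =
      b ^ 2 * (5 * (β * (5 / 2 - b ^ 2 * u) ^ 2 + m ^ 2)) by ring]
  refine mul_le_mul_of_nonneg_left ?_ (sq_nonneg b)
  have h2 : (1 + b * m) ^ 2 ≤ 2 + 2 * m ^ 2 := by
    have : (b * m) ^ 2 ≤ m ^ 2 := by rw [mul_pow]; nlinarith [sq_nonneg m]
    nlinarith [sq_nonneg (1 - b * m)]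
  have h3 : β ^ 2 * (1 + b * m) ^ 2 ≤ 2 * β + 2 * m ^ 2 := by
    have : β ^ 2 ≤ β := by nlinarith
    have : β ^ 2 * m ^ 2 ≤ 1 * m ^ 2 := mul_le_mul_of_nonneg_right (by nlinarith) (sq_nonneg m)
    nlinarith [mul_le_mul_of_nonneg_left h2 (sq_nonneg β)]
  have h4 : b ^ 2 * u ^ 2 ≤ m ^ 2 := by nlinarith [sq_nonneg u]
  nlinarith [mul_le_mul_of_nonneg_left h1 hβ0.le, mul_le_mul_of_nonneg_left hu3 hβ0.le,
    sq_nonneg m]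

/-- The mechanism is that of `moment_ineq_five`; the constant `8` bounds `3 ^ 2 - β ^ 3` from below.
-/
theorem moment_ineq_six {b β m u : ℝ} (hb0 : 0 ≤ b) (hb1 : b < 1) (hβ0 : 0 < β) (hβ1 : β < 1)
    (hu : u = b ^ 3 * m - (1 - b)) (hm : m = b ^ 3 * u + (1 - b) * 3) (hm0 : 0 < m)
    (hbm : 1 - b ≤ m) :
    (b ^ 2 * u) ^ 2 + β * (b * u) ^ 2 + β ^ 2 * (1 + u) ^ 2 ≤
      8 * (β ^ 2 * (3 - m) ^ 2 + ((b ^ 2 * m) ^ 2 + β * (b * m) ^ 2)) := by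
  have hb2 : b ^ 2 ≤ 1 := pow_le_one₀ hb0 hb1.le
  have hb3 : b ^ 3 ≤ 1 := pow_le_one₀ hb0 hb1.le
  have hb3' : 0 ≤ b ^ 3 := pow_nonneg hb0 3
  have hum : u ≤ m := by nlinarith
  have hu1' : -m ≤ u := by nlinarith
  have hu1 : -1 ≤ u := by nlinarith
  have hu2 : u ≤ 1 := by
    by_contra! hlt
    have h1 : u * (1 - b ^ 6) = (1 - b) * (3 * b ^ 3 - 1) := by
      rw [hm] at hu; linear_combination hu
    have h2 : (1 - b) * (3 * b ^ 3 - 1) ≤ 1 - b ^ 6 := by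
      nlinarith [mul_nonneg (sub_nonneg.2 hb1.le)
        (show 0 ≤ b ^ 5 + b ^ 4 + b ^ 2 + b - 2 * b ^ 3 + 2 by
          nlinarith [pow_nonneg hb0 5, pow_nonneg hb0 4, sq_nonneg b])]
    have h3 : b ^ 6 < 1 := pow_lt_one₀ hb0 hb1 (by norm_num)
    nlinarith
  have e : 3 - m = b * (3 - b ^ 2 * u) := by rw [hm]; ring
  have e1 : 1 + u = b * (1 + b ^ 2 * m) := by rw [hu]; ring
  have hu4 : u ^ 2 ≤ m ^ 2 := by nlinarith
  have h1 : 4 ≤ (3 - b ^ 2 * u) ^ 2 := by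
    have : 2 ≤ 3 - b ^ 2 * u := by nlinarith [sq_nonneg b]
    nlinarith
  rw [e1, e, show (b ^ 2 * u) ^ 2 + β * (b * u) ^ 2 + β ^ 2 * (b * (1 + b ^ 2 * m)) ^ 2 =
      b ^ 2 * (b ^ 2 * u ^ 2 + β * u ^ 2 + β ^ 2 * (1 + b ^ 2 * m) ^ 2) by ring,
    show 8 * (β ^ 2 * (b * (3 - b ^ 2 * u)) ^ 2 + ((b ^ 2 * m) ^ 2 + β * (b * m) ^ 2)) =
      b ^ 2 * (8 * (β ^ 2 * (3 - b ^ 2 * u) ^ 2 + b ^ 2 * m ^ 2 + β * m ^ 2)) by ring]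
  refine mul_le_mul_of_nonneg_left ?_ (sq_nonneg b)
  have h2 : (1 + b ^ 2 * m) ^ 2 ≤ 2 + 2 * (b ^ 2 * m ^ 2) := by
    have : (b ^ 2 * m) ^ 2 ≤ b ^ 2 * m ^ 2 := by
      rw [mul_pow]
      exact mul_le_mul_of_nonneg_right (by nlinarith [sq_nonneg b]) (sq_nonneg m)
    nlinarith [sq_nonneg (1 - b ^ 2 * m)]
  have h3 : β ^ 2 * (b ^ 2 * m ^ 2) ≤ 1 * (b ^ 2 * m ^ 2) :=
    mul_le_mul_of_nonneg_right (by nlinarith) (by positivity)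
  nlinarith [mul_le_mul_of_nonneg_left h2 (sq_nonneg β),
    mul_le_mul_of_nonneg_left h1 (sq_nonneg β), mul_le_mul_of_nonneg_left hu4 hβ0.le,
    mul_le_mul_of_nonneg_left hu4 (sq_nonneg b), sq_nonneg β,
    (by positivity : 0 ≤ b ^ 2 * m ^ 2), (by positivity : 0 ≤ β * m ^ 2)]

/-! ### Comparison of `A` with `G ^ 2 * B` for both methods. -/

/-- Comparison of the two limits of the second moment in terms of the inputs of a period. -/
theorem limit_sub_eq {P : ℕ} (hP : 3 < P) {A B Q R β : ℝ} (c : ℝ)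
    (hA : A = β ^ 3 * B + (1 - β) * R) (hB : B = β ^ (P - 3) * A + (1 - β) * Q) :
    (c * B - A) * (1 - β ^ P) = (1 - β) * ((c - β ^ 3) * Q - (1 - c * β ^ (P - 3)) * R) := by
  have hbP : β ^ P = β ^ 3 * β ^ (P - 3) := by rw [← pow_add]; congr 1; omega
  rw [hbP]
  linear_combination (c * β ^ (P - 3) - 1) * hA + (c - β ^ 3) * hB

theorem le_mul_limit_iff {P : ℕ} (hP : 3 < P) {A B Q R β c : ℝ} (h0 : 0 < β) (h1 : β < 1)
    (hA : A = β ^ 3 * B + (1 - β) * R) (hB : B = β ^ (P - 3) * A + (1 - β) * Q) :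
    A ≤ c * B ↔ (1 - c * β ^ (P - 3)) * R ≤ (c - β ^ 3) * Q := by
  have h := limit_sub_eq hP c hA hB
  have hP1 : 0 < 1 - β ^ P := sub_pos.2 (pow_lt_one₀ h0.le h1 (by omega))
  have h1' : 0 < 1 - β := sub_pos.2 h1
  rw [← sub_nonneg, ← mul_nonneg_iff_of_pos_right hP1, h, mul_nonneg_iff_of_pos_left h1',
    sub_nonneg]

/-- In `le_mul_limit_iff` with `c = G ^ 2`, the cross terms `G ^ 2 * β ^ (P - 1)` on the two sides
cancel. -/
theorem adashift_limit_le_iff {P : ℕ} (hP : 3 < P) {A B β G : ℝ} (h0 : 0 < β) (h1 : β < 1)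
    (hA : A = β ^ 3 * B + (1 - β) * β ^ 2)
    (hB : B = β ^ (P - 3) * A + (1 - β) * (β ^ (P - 4) * G ^ 2)) :
    A ≤ G ^ 2 * B ↔ β ^ 2 ≤ G ^ 4 * β ^ (P - 4) := by
  rw [le_mul_limit_iff hP h0 h1 hA hB, show P - 3 = P - 4 + 1 by omega, pow_succ,
    ← sub_nonneg, ← sub_nonneg (a := G ^ 4 * β ^ (P - 4))]
  ring_nf

/-- If the AdaShift limits are favourable, then so are the ACProp limits. -/
theorem acprop_limit_le {P : ℕ} (hP : 3 < P) {A B b β m u : ℝ} (hb0 : 0 ≤ b) (hb1 : b < 1)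
    (h0 : 0 < β) (h1 : β < 1)
    (hu : u = b ^ (P - 3) * m - (1 - b)) (hm : m = b ^ 3 * u + (1 - b) * ((P : ℝ) / 2))
    (hA : A = β ^ 3 * B + (1 - β) * ((b ^ 2 * u) ^ 2 + β * (b * u) ^ 2 + β ^ 2 * (1 + u) ^ 2))
    (hB : B = β ^ (P - 3) * A + (1 - β) * (β ^ (P - 4) * ((P : ℝ) / 2 - m) ^ 2 +
        ∑ i ∈ Finset.range (P - 4), β ^ i * (b ^ (P - 4 - i) * m) ^ 2))
    (hAda : β ^ 2 ≤ ((P : ℝ) / 2) ^ 4 * β ^ (P - 4)) : A ≤ ((P : ℝ) / 2) ^ 2 * B := by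
  rw [le_mul_limit_iff hP h0 h1 hA hB]
  obtain ⟨hm0, -, hbm, -⟩ := first_moment_bounds hP hb0 hb1 hu hm
  have hβ3 : β ^ 3 ≤ 1 := pow_le_one₀ h0.le h1.le
  have hR0 : 0 ≤ (b ^ 2 * u) ^ 2 + β * (b * u) ^ 2 + β ^ 2 * (1 + u) ^ 2 := by positivity
  have hQ0 : 0 ≤ β ^ (P - 4) * ((P : ℝ) / 2 - m) ^ 2 +
      ∑ i ∈ Finset.range (P - 4), β ^ i * (b ^ (P - 4 - i) * m) ^ 2 :=
    add_nonneg (by positivity) (Finset.sum_nonneg fun i _ => by positivity)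
  have hz : 0 ≤ ((P : ℝ) / 2) ^ 2 * β ^ (P - 3) := by positivity
  rcases Nat.lt_or_ge P 7 with h7 | h7
  · interval_cases P
    · have := moment_ineq_four hb0 hb1 h0 h1 (by simpa using hu)
        (by rw [hm]; push_cast; ring) hm0
      norm_num at *
      linarith
    · have h5 := moment_ineq_five hb0 hb1 h0 h1 hu (by rw [hm]; push_cast; ring) hm0 hbm
      norm_num at *
      have e1 := mul_nonneg hz hR0
      have e2 : 5 * (β * (5 / 2 - m) ^ 2 + (b * m) ^ 2) ≤
          (25 / 4 - β ^ 3) * (β * (5 / 2 - m) ^ 2 + (b * m) ^ 2) :=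
        mul_le_mul_of_nonneg_right (by linarith) hQ0
      linarith
    · have h6 := moment_ineq_six hb0 hb1 h0 h1 hu (by rw [hm]; push_cast; ring) hm0 hbm
      norm_num [Finset.sum_range_succ] at *
      have e1 := mul_nonneg hz hR0
      have e2 := mul_le_mul_of_nonneg_right (show 8 ≤ 9 - β ^ 3 by linarith) hQ0
      linarith
  · obtain ⟨n, rfl⟩ := Nat.exists_eq_add_of_le' h7
    change β ^ 2 ≤ _ * β ^ (n + 3) at hAda
    obtain ⟨G, hG⟩ : ∃ G, G = ((n + 7 : ℕ) : ℝ) / 2 := ⟨_, rfl⟩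
    rw [← hG] at hAda hm
    rw [← hG]
    have hG1 : 1 ≤ G := by rw [hG]; push_cast; linarith [Nat.cast_nonneg (α := ℝ) n]
    have hAda' : 1 ≤ G ^ 4 * β ^ (n + 1) := by
      refine le_of_mul_le_mul_right ?_ (pow_pos h0 2)
      calc 1 * β ^ 2 = β ^ 2 := one_mul _
        _ ≤ _ := hAda
        _ = _ := by ring
    have hmain := moment_ineq_large hG hb0 hb1 h0 h1 hu hm hAda'
    change (1 - G ^ 2 * β ^ (n + 4)) * _ ≤ (G ^ 2 - β ^ 3) * (β ^ (n + 3) * (G - m) ^ 2 +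
        ∑ i ∈ Finset.range (n + 3), β ^ i * (b ^ (n + 3 - i) * m) ^ 2)
    have hG2 : 1 ≤ G ^ 2 := one_le_pow₀ hG1
    refine le_of_mul_le_mul_left ?_ (by positivity : 0 < G ^ 2)
    -- The AdaShift condition enters a second time, now to compare the two coefficients of
    -- `le_mul_limit_iff`.
    have e1 : G ^ 2 * (1 - G ^ 2 * β ^ (n + 4)) ≤ G ^ 2 - β ^ 3 := by
      have := mul_le_mul_of_nonneg_right hAda' (pow_nonneg h0.le 3)
      have e : G ^ 4 * β ^ (n + 1) * β ^ 3 = G ^ 2 * (G ^ 2 * β ^ (n + 4)) := by ring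
      linarith
    have e2 := mul_le_mul_of_nonneg_right e1 hR0
    have e3 := mul_le_mul_of_nonneg_left hmain (by linarith : 0 ≤ G ^ 2 - β ^ 3)
    linarith

/-! ### The sign of the limiting drift and the conclusion. -/

/-- Strictness comes from `ε < G * ε`, so even equality in `h` is enough. -/
theorem descent_condition {G A B ε : ℝ} (hG : 1 < G) (hε : 0 < ε) (h : A ≤ G ^ 2 * B) :
    1 / (√B + ε) < G / (√A + ε) := by
  have h1 : √A ≤ G * √B := by
    have := Real.sqrt_le_sqrt h
    rwa [Real.sqrt_mul (sq_nonneg G), Real.sqrt_sq (by linarith)] at this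
  rw [div_lt_div_iff₀ (by positivity) (by positivity)]
  nlinarith

theorem ascent_condition {G A B : ℝ} (hG : 1 < G) (hB : 0 ≤ B) (h : G ^ 2 * B < A) :
    ∃ ε₀ : ℝ, 0 < ε₀ ∧ ∀ ε : ℝ, 0 < ε → ε < ε₀ → G / (√A + ε) < 1 / (√B + ε) := by
  have h1 : G * √B < √A := by
    have := Real.sqrt_lt_sqrt (by positivity) h
    rwa [Real.sqrt_mul (sq_nonneg G), Real.sqrt_sq (by linarith)] at this
  have hG1 : 0 < G - 1 := by linarith
  -- This is the exact value of `ε` at which the drift vanishes.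
  refine ⟨(√A - G * √B) / (G - 1), div_pos (by linarith) hG1, fun ε hε hlt => ?_⟩
  rw [lt_div_iff₀ hG1] at hlt
  rw [div_lt_div_iff₀ (by positivity) (by positivity)]
  linarith

theorem one_lt_half_period {P : ℕ} (hP : 3 < P) : 1 < (P : ℝ) / 2 := by
  have : (4 : ℝ) ≤ P := by exact_mod_cast hP
  linarith

/-- If the AdaShift limits are unfavourable, then AdaShift diverges for small `ε`. -/
theorem exists_adashift_diverges {P : ℕ} (hP : 3 < P) {β : ℝ} (h0 : 0 < β) (h1 : β < 1)
    (h : ((P : ℝ) / 2) ^ 4 * β ^ (P - 4) < β ^ 2) :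
    ∃ ε₀ : ℝ, 0 < ε₀ ∧ ∀ ε : ℝ, 0 < ε → ε < ε₀ → ∀ α₀ : ℝ, 0 < α₀ →
      ∀ x₀ ∈ Set.Icc (0 : ℝ) 1, ¬ AdaShiftConverges β P ε α₀ x₀ := by
  obtain ⟨A, B, hA, hB, hlim⟩ := exists_adashift_limits hP h0.le h1
  have hlt : ((P : ℝ) / 2) ^ 2 * B < A := by
    by_contra! hle
    exact absurd ((adashift_limit_le_iff hP h0 h1 hA hB).1 hle) (not_le.2 h)
  have hB0 : 0 ≤ B := by
    -- Taking `c = 0` eliminates `B` and exhibits the sign of `A`.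
    have e := limit_sub_eq hP 0 hA hB
    have hP1 : 0 < 1 - β ^ P := sub_pos.2 (pow_lt_one₀ h0.le h1 (by omega))
    have hA0 : 0 ≤ A := by
      by_contra! hneg
      have : 0 < (0 * B - A) * (1 - β ^ P) := mul_pos (by linarith) hP1
      rw [e] at this
      have h2 : 0 ≤ (1 - β) * (β ^ 3 * (β ^ (P - 4) * ((P : ℝ) / 2) ^ 2) + β ^ 2) :=
        mul_nonneg (by linarith) (by positivity)
      linarith
    rw [hB]
    exact add_nonneg (by positivity) (mul_nonneg (by linarith) (by positivity))
  obtain ⟨ε₀, hε₀, hasc⟩ := ascent_condition (one_lt_half_period hP) hB0 hlt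
  refine ⟨ε₀, hε₀, fun ε hε hεlt α₀ hα x₀ hx₀ => ?_⟩
  obtain ⟨h2, h3⟩ := hlim (fun t => (adashiftState (sparseLoss P) β α₀ ε x₀ t).v)
    (fun t => by simp only [adashiftState, deriv_sparseLoss])
  exact sparse_descent_not_tendsto_zero hP hα hε (x := adashift (sparseLoss P) β α₀ ε x₀)
    (s := fun t => (adashiftState (sparseLoss P) β α₀ ε x₀ t).v) hx₀
    (fun t => by simp only [adashift, adashiftState, deriv_sparseLoss]) h2 h3
    (hasc ε hε hεlt)

/-- ACProp converges for every `ε` as soon as its limiting second moments are favourable. -/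
theorem acprop_converges {P : ℕ} (hP : 3 < P) {b β : ℝ} (hb0 : 0 ≤ b) (hb1 : b < 1)
    (h0 : 0 ≤ β) (h1 : β < 1)
    (h : ∀ A B m u : ℝ, u = b ^ (P - 3) * m - (1 - b) →
      m = b ^ 3 * u + (1 - b) * ((P : ℝ) / 2) →
      A = β ^ 3 * B + (1 - β) * ((b ^ 2 * u) ^ 2 + β * (b * u) ^ 2 + β ^ 2 * (1 + u) ^ 2) →
      B = β ^ (P - 3) * A + (1 - β) * (β ^ (P - 4) * ((P : ℝ) / 2 - m) ^ 2 +
        ∑ i ∈ Finset.range (P - 4), β ^ i * (b ^ (P - 4 - i) * m) ^ 2) →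
      A ≤ ((P : ℝ) / 2) ^ 2 * B)
    {ε α₀ x₀ : ℝ} (hε : 0 < ε) (hα : 0 < α₀) (hx₀ : x₀ ∈ Set.Icc (0 : ℝ) 1) :
    ACPropConverges b β P ε α₀ x₀ := by
  obtain ⟨A, B, m, u, hu, hm, hA, hB, h2, h3⟩ := exists_acprop_limits hP hb0 hb1 h0 h1
    (μ := fun t => (acpropState (sparseLoss P) b β α₀ ε x₀ t).m)
    (s := fun t => (acpropState (sparseLoss P) b β α₀ ε x₀ t).s)
    (fun t => by simp only [acpropState, deriv_sparseLoss])
    (fun t => by simp only [acpropState, deriv_sparseLoss])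
  exact sparse_descent_tendsto_zero hP hα hε (x := acprop (sparseLoss P) b β α₀ ε x₀)
    (s := fun t => (acpropState (sparseLoss P) b β α₀ ε x₀ t).s) hx₀
    (fun t => by simp only [acprop, acpropState, deriv_sparseLoss]) h2 h3
    (descent_condition (one_lt_half_period hP) hε (h A B m u hu hm hA hB))

theorem lemma3p4 :
    (∃ (β₁ β₂ : ℝ) (P : ℕ), 0 < β₁ ∧ β₁ < 1 ∧ 0 < β₂ ∧ β₂ < 1 ∧ 3 < P ∧
      ∃ ε₀ : ℝ, 0 < ε₀ ∧ ∀ ε : ℝ, 0 < ε → ε < ε₀ →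
        ∀ α₀ : ℝ, 0 < α₀ → ∀ x₀ ∈ Set.Icc (0 : ℝ) 1,
          ACPropConverges β₁ β₂ P ε α₀ x₀ ∧ ¬ AdaShiftConverges β₂ P ε α₀ x₀) ∧
    (∀ (β₁ β₂ : ℝ) (P : ℕ), 0 ≤ β₁ → β₁ < 1 → 0 < β₂ → β₂ < 1 → 3 < P →
      ∃ ε₀ : ℝ, 0 < ε₀ ∧ ∀ ε : ℝ, 0 < ε → ε < ε₀ →
        ∀ α₀ : ℝ, 0 < α₀ → ∀ x₀ ∈ Set.Icc (0 : ℝ) 1,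
          AdaShiftConverges β₂ P ε α₀ x₀ → ACPropConverges β₁ β₂ P ε α₀ x₀) := by
  constructor
  -- For `P = 7` the AdaShift condition fails exactly when `β₂ < (2 / 7) ^ 4`, which is about `1 /
  -- 150`. With `β₁ = 1 / 2` the first-moment limits are explicit and the ACProp inequality is a
  -- numerical check.
  · refine ⟨1 / 2, 1 / 200, 7, by norm_num, by norm_num, by norm_num, by norm_num, by norm_num, ?_⟩
    obtain ⟨ε₀, hε₀, hdiv⟩ := exists_adashift_diverges (P := 7) (β := 1 / 200) (by norm_num)
      (by norm_num) (by norm_num) (by norm_num)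
    refine ⟨ε₀, hε₀, fun ε hε hlt α₀ hα x₀ hx₀ => ⟨?_, hdiv ε hε hlt α₀ hα x₀ hx₀⟩⟩
    refine acprop_converges (by norm_num) (by norm_num) (by norm_num) (by norm_num) (by norm_num)
      (fun A B m u hu hm hA hB => ?_) hε hα hx₀
    rw [le_mul_limit_iff (by norm_num) (by norm_num) (by norm_num) hA hB]
    norm_num at hu hm
    have hm' : m = 216 / 127 := by linarith
    have hu' : u = -50 / 127 := by linarith
    rw [hm', hu']
    norm_num [Finset.sum_range_succ]
  · intro β₁ β₂ P hb0 hb1 h0 h1 hP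
    rcases le_or_gt (β₂ ^ 2) (((P : ℝ) / 2) ^ 4 * β₂ ^ (P - 4)) with h | h
    -- ACProp converges here for every `ε > 0`, so the bound `1` is arbitrary.
    · refine ⟨1, one_pos, fun ε hε _ α₀ hα x₀ hx₀ _ => ?_⟩
      exact acprop_converges hP hb0 hb1 h0.le h1
        (fun A B m u hu hm hA hB => acprop_limit_le hP hb0 hb1 h0 h1 hu hm hA hB h) hε hα hx₀
    · obtain ⟨ε₀, hε₀, hdiv⟩ := exists_adashift_diverges hP h0 h1 h
      exact ⟨ε₀, hε₀, fun ε hε hlt α₀ hα x₀ hx₀ hc =>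
        absurd hc (hdiv ε hε hlt α₀ hα x₀ hx₀)⟩
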